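/- For $n\ge 1$ let $L_n$ be the $n$-dimensional lattice, i.e. the graph with vertex set $\mathbb{Z}^n$ in which $x$ and $y$ are adjacent if and only if $\sum_{i=1}^n|x_i-y_i|=1$. For a vertex $v$ and an integer $r\ge 1$ let $B_r(v)$ be the set of vertices at graph distance at most $r$ from $v$. A nonempty set $C$ of vertices is an $r$-identifying code if $B_r(v)\cap C\neq\emptyset$ for every vertex $v$ and $B_r(u)\cap C\neq B_r(v)\cap C$ for all vertices $u\neq v$. With $Q_m=\{x\in\mathbb{Z}^n: |x_i|\le m \text{ for all } i\}$, the density of $C$ is $\limsup_{m\to\infty}|C\cap Q_m|/|Q_m|$, and $\mathcal{D}(L_n,r)$ denotes the minimum possible density (the infimum of the densities) of an $r$-identifying code of $L_n$. Theorem. There is a constant $b$ such that for all sufficiently large $n$, $$\frac{1}{n+1}\le \mathcal{D}(L_n,1)\le\left(1+\frac{b\ln\ln n}{\ln n}\right)\frac{1}{n+1}.$$ -/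

import Mathlib

/-- The `n`-dimensional lattice `L_n`: the vertex set is `ℤⁿ`, and `x`, `y` are adjacent exactly
when `∑ i, |x i - y i| = 1`. -/
def latticeGraph (n : ℕ) : SimpleGraph (Fin n → ℤ) where
  Adj x y := ∑ i, |x i - y i| = 1
  symm := ⟨fun x y h => by simpa only [abs_sub_comm] using h⟩
  loopless := ⟨fun x h => by simp at h⟩

/-- The closed ball `B_r(v)` of radius `r` centred at `v` in a graph (distance at most `r`). -/
def graphBall {V : Type*} (G : SimpleGraph V) (r : ℕ) (v : V) : Set V :=
  {u | G.edist u v ≤ (r : ℕ∞)}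

/-- `C` is an `r`-identifying code of `G`: a nonempty set of vertices such that the identifying
sets `B_r(v) ∩ C` are nonempty and pairwise distinct. -/
def IsIdentifyingCode {V : Type*} (G : SimpleGraph V) (r : ℕ) (C : Set V) : Prop :=
  C.Nonempty ∧
    (∀ v : V, (graphBall G r v ∩ C).Nonempty) ∧
    ∀ u v : V, u ≠ v → graphBall G r u ∩ C ≠ graphBall G r v ∩ C

/-- The box `Q_m` of all `x ∈ ℤⁿ` with `|x i| ≤ m` for every `i`. -/
def latticeBox (n m : ℕ) : Set (Fin n → ℤ) :=
  {x | ∀ i, |x i| ≤ (m : ℤ)}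

/-- The box is finite, so that the cardinalities `Set.ncard` below are the true ones. -/
theorem latticeBox_finite (n m : ℕ) : (latticeBox n m).Finite := by
  refine (Set.finite_Icc (fun _ : Fin n => -(m : ℤ)) (fun _ => (m : ℤ))).subset ?_
  intro x hx
  exact ⟨fun i => (abs_le.mp (hx i)).1, fun i => (abs_le.mp (hx i)).2⟩

/-- The density `limsup_{m → ∞} |C ∩ Q_m| / |Q_m|` of a set `C ⊆ ℤⁿ`. The quotients lie
in `[0, 1]`. -/
noncomputable def codeDensity {n : ℕ} (C : Set (Fin n → ℤ)) : ℝ :=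
  Filter.limsup
    (fun m : ℕ => ((C ∩ latticeBox n m).ncard : ℝ) / ((latticeBox n m).ncard : ℝ))
    Filter.atTop

/-- `𝒟(L_n, r)`: the minimum possible density of an `r`-identifying code of `L_n`, as the infimum
of the set of all such densities (a set of reals that is bounded below by `0`). -/
noncomputable def minCodeDensity (n r : ℕ) : ℝ :=
  sInf {d : ℝ | ∃ C : Set (Fin n → ℤ), IsIdentifyingCode (latticeGraph n) r C ∧
    d = codeDensity C}

/-! Lower bound: count pairs consisting of a vertex and a codeword in its ball. The identifying sets
are nonempty and distinct, so at most one per codeword is a singleton and the others have at least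
two elements. A codeword lies in `2 n + 1` balls, so up to a boundary effect twice the number of
vertices is at most `2 n + 2` times the number of codewords (`two_mul_card_box_le`).

Upper bound: let `K` be a binary covering code of radius one and let `C` be the points whose parity
vector lies in `K`. A point `v` outside `C` has two opposite neighbours `v ± e_i` in `C`, and `v` is
the only centre of a unit ball containing both. Two points of `C` with the same identifying set
would be adjacent, and parity then again yields an opposite pair in `C`. Hence `C` is identifying,
with density at most `|K| / 2 ^ n`.

Good coverings are fibres of labellings in which every unit ball sees all `N` labels: the smallest
fibre has density at most `1 / N`, so the aim is `N` close to `n + 1`. Doubling multiplies both `n +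
1` and `N` by two. A finite ring `R` with `|R| ≤ 2 ^ s` gives `N = |R| ^ k` and `n` about `|R| ^ k *
2 ^ s / |Rˣ|`, which is good when `|R|` is barely below `2 ^ s` and almost all elements are units.
Such an `R` is a product of 500 prime fields whose order `Q` is below a power of `4` by a factor `1
- O(1 / M)`. It exists because the logarithms of primes, sorted into `M` classes modulo `log 4`,
occupy a positive proportion of the classes (Chebyshev from below, Selberg's sieve in each class),
so that Cauchy–Davenport makes their 500-fold sums hit every class.

Finally, `log Q` misses a multiple of `log 2` by some `ε` of order `1 / M`, so the numbers `a log 2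
+ k log Q` have gaps at most `ε` beyond a multiple of `M log M`. Every such length `n` is therefore
served with relative loss `O(1 / M)`, and `M` can be taken of order `log n / log log n`. -/

/-! ### Labellings of binary words and covering codes. -/

/-- The words `x` and `y` differ in at most one position. -/
def DifferAtMostOnce {ι α : Type*} (x y : ι → α) : Prop :=
  ∀ i j, x i ≠ y i → x j ≠ y j → i = j

/-- A labelling of the binary words such that from every word each label can be reached by
changing at most one letter. -/
def IsLabelling {ι G : Type*} (H : (ι → ZMod 2) → G) : Prop :=
  ∀ x g, ∃ y, DifferAtMostOnce x y ∧ H y = g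

theorem DifferAtMostOnce.refl {ι α : Type*} (x : ι → α) : DifferAtMostOnce x x :=
  fun _ _ h => absurd rfl h

theorem differAtMostOnce_update {ι α : Type*} [DecidableEq ι] (x : ι → α) (i : ι) (c : α) :
    DifferAtMostOnce x (Function.update x i c) := by
  have key : ∀ j, x j ≠ Function.update x i c j → j = i := by
    intro j hj
    by_contra h
    exact hj (by rw [Function.update_of_ne h])
  intro j k hj hk
  rw [key j hj, key k hk]

theorem IsLabelling.comp_surjective {ι G G' : Type*} {H : (ι → ZMod 2) → G} (hH : IsLabelling H)
    {f : G → G'} (hf : Function.Surjective f) : IsLabelling (f ∘ H) := by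
  intro x g
  obtain ⟨g', rfl⟩ := hf g
  obtain ⟨y, hy, rfl⟩ := hH x g'
  exact ⟨y, hy, rfl⟩

theorem IsLabelling.comp_injective {ι κ G : Type*} {H : (κ → ZMod 2) → G} (hH : IsLabelling H)
    {f : κ → ι} (hf : Function.Injective f) :
    IsLabelling (fun x : ι → ZMod 2 => H (x ∘ f)) := by
  intro x g
  obtain ⟨y, hy, hg⟩ := hH (x ∘ f) g
  have key : ∀ i, x i ≠ Function.extend f y x i → ∃ k, f k = i ∧ x (f k) ≠ y k := by
    intro i hi
    by_cases h : ∃ k, f k = i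
    · obtain ⟨k, rfl⟩ := h
      rw [hf.extend_apply] at hi
      exact ⟨k, rfl, hi⟩
    · rw [Function.extend_apply' _ _ _ h] at hi
      exact absurd rfl hi
  refine ⟨Function.extend f y x, ?_, ?_⟩
  · intro i j hi hj
    obtain ⟨k, rfl, hk⟩ := key i hi
    obtain ⟨l, rfl, hl⟩ := key j hj
    rw [hy k l hk hl]
  · rw [← hg]
    exact congrArg H (funext fun k => by simp [hf.extend_apply])

/-- A labelling of the words of length `n` by `N` labels exists. -/
def HasLabelling (n N : ℕ) : Prop :=
  ∃ H : (Fin n → ZMod 2) → Fin N, IsLabelling H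

theorem IsLabelling.hasLabelling {ι G : Type*} [Fintype ι] [Fintype G] {H : (ι → ZMod 2) → G}
    (hH : IsLabelling H) : HasLabelling (Fintype.card ι) (Fintype.card G) :=
  ⟨_, (hH.comp_injective (Fintype.equivFin ι).injective).comp_surjective
    (Fintype.equivFin G).surjective⟩

theorem HasLabelling.mono {n n' N : ℕ} (h : HasLabelling n N) (hn : n ≤ n') :
    HasLabelling n' N := by
  obtain ⟨H, hH⟩ := h
  exact ⟨_, hH.comp_injective (Fin.castLE_injective hn)⟩

/-- A word is a triple `(a, b, c)` with `c` a single bit, labelled by the parity of `b` and `c`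
together and by `H (a + b)`. A required change of `a + b` at `i` can be made in `a` or in `b`, and
exactly one of the two gives the required parity; if `a + b` need not change, `c` adjusts the parity
alone. -/
theorem HasLabelling.double {n N : ℕ} (h : HasLabelling n N) :
    HasLabelling (2 * n + 1) (2 * N) := by
  obtain ⟨H, hH⟩ := h
  let H' : ((Fin n ⊕ Fin n) ⊕ Unit → ZMod 2) → ZMod 2 × Fin N := fun x =>
    (∑ i, x (.inl (.inr i)) + x (.inr ()), H fun i => x (.inl (.inl i)) + x (.inl (.inr i)))
  have key : IsLabelling H' := by
    rintro x ⟨c, g⟩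
    obtain ⟨y, hy, rfl⟩ := hH (fun i => x (.inl (.inl i)) + x (.inl (.inr i))) g
    by_cases hd : ∃ i, x (.inl (.inl i)) + x (.inl (.inr i)) ≠ y i
    · obtain ⟨i, hi⟩ := hd
      have hyi : ∀ j, j ≠ i → x (.inl (.inl j)) + x (.inl (.inr j)) = y j := by
        intro j hj
        by_contra hne
        exact hj (hy j i hne hi)
      have hyi' : x (.inl (.inl i)) + x (.inl (.inr i)) + 1 = y i := by
        revert hi
        generalize x (.inl (.inl i)) + x (.inl (.inr i)) = a
        generalize y i = b
        revert a b
        decide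
      by_cases hc : ∑ i, x (.inl (.inr i)) + x (.inr ()) = c
      · refine ⟨Function.update x (.inl (.inl i)) (x (.inl (.inl i)) + 1),
          differAtMostOnce_update _ _ _, ?_⟩
        refine Prod.ext ?_ ?_
        · simpa [H'] using hc
        · simp only [H']
          congr 1
          funext j
          by_cases hj : j = i
          · subst hj
            rw [← hyi']
            simp
            ring
          · simp [Function.update_of_ne, hj, hyi j hj]
      · refine ⟨Function.update x (.inl (.inr i)) (x (.inl (.inr i)) + 1),
          differAtMostOnce_update _ _ _, ?_⟩
        have hc' : ∑ i, x (.inl (.inr i)) + x (.inr ()) + 1 = c := by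
          revert hc
          generalize ∑ i, x (.inl (.inr i)) + x (.inr ()) = a
          revert a c
          decide
        refine Prod.ext ?_ ?_
        · simp only [H', ← hc']
          have : ∀ j, Function.update x (.inl (.inr i)) (x (.inl (.inr i)) + 1) (.inl (.inr j))
              = x (.inl (.inr j)) + if j = i then 1 else 0 := by
            intro j
            by_cases hj : j = i
            · subst hj; simp
            · simp [Function.update_of_ne, hj]
          simp only [this, Finset.sum_add_distrib]
          simp
          ring
        · simp only [H']
          congr 1
          funext j
          by_cases hj : j = i
          · subst hj
            rw [← hyi']
            simp
            ring
          · simp [Function.update_of_ne, hj, hyi j hj]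
    · push Not at hd
      refine ⟨Function.update x (.inr ()) (c - ∑ i, x (.inl (.inr i))),
        differAtMostOnce_update _ _ _, ?_⟩
      simp [H', hd]
  have := key.hasLabelling
  simp only [Fintype.card_sum, Fintype.card_prod, Fintype.card_fin, Fintype.card_unit,
    ZMod.card] at this
  rwa [← two_mul] at this

/-- The ratio of `n + 1` to `N` is invariant under doubling, so powers of two come free. -/
theorem HasLabelling.double_iterate {n N : ℕ} (h : HasLabelling n N) (a : ℕ) :
    HasLabelling (2 ^ a * (n + 1) - 1) (2 ^ a * N) := by
  induction a with
  | zero => simpa using h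
  | succ a ih =>
    have := ih.double
    have hpos : 0 < 2 ^ a * (n + 1) := by positivity
    convert this using 1
    · rw [pow_succ, mul_comm (2 ^ a) 2, mul_assoc]
      omega
    · ring

/-- A fibre of a labelling by `N` labels of density at most `1 / N`. -/
theorem HasLabelling.exists_covering {n N : ℕ} (h : HasLabelling n N) :
    ∃ K : Finset (Fin n → ZMod 2), (∀ x, ∃ y ∈ K, DifferAtMostOnce x y) ∧
      K.card * N ≤ 2 ^ n := by
  classical
  obtain ⟨H, hH⟩ := h
  have hN : 0 < N := lt_of_le_of_lt (Nat.zero_le _) (H 0).isLt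
  have : Nonempty (Fin N) := ⟨⟨0, hN⟩⟩
  by_contra hcon
  push Not at hcon
  have hlt : ∀ g, 2 ^ n < (Finset.univ.filter fun x => H x = g).card * N := by
    intro g
    apply hcon
    intro x
    obtain ⟨y, hy, hyg⟩ := hH x g
    exact ⟨y, by simp [hyg], hy⟩
  have hsum : ∑ g, (Finset.univ.filter fun x => H x = g).card = 2 ^ n := by
    rw [← Finset.card_eq_sum_card_fiberwise (fun _ _ => Finset.mem_univ _)]
    simp [ZMod.card]
  have : ∑ _g : Fin N, 2 ^ n < ∑ g, (Finset.univ.filter fun x => H x = g).card * N :=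
    Finset.sum_lt_sum_of_nonempty Finset.univ_nonempty fun g _ => hlt g
  rw [← Finset.sum_mul, hsum] at this
  simp [mul_comm] at this

/-- The Hamming labelling. -/
theorem isLabelling_hamming (s : ℕ) :
    IsLabelling (fun x : ({v : Fin s → ZMod 2 // v ≠ 0} → ZMod 2) => ∑ v, x v • v.1) := by
  classical
  intro x g
  by_cases hg : g - ∑ v, x v • v.1 = 0
  · exact ⟨x, .refl x, (sub_eq_zero.1 hg).symm⟩
  · let w : {v : Fin s → ZMod 2 // v ≠ 0} := ⟨_, hg⟩
    refine ⟨Function.update x w (x w + 1), differAtMostOnce_update _ _ _, ?_⟩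
    have : ∀ v, Function.update x w (x w + 1) v • v.1
        = x v • v.1 + if v = w then w.1 else 0 := by
      intro v
      by_cases hv : v = w
      · subst hv; simp [add_smul]
      · simp [Function.update_of_ne, hv]
    simp only [this, Finset.sum_add_distrib]
    simp [w]

/-! ### Labellings by free modules over a finite ring. -/

section RingCode

variable {R : Type*} [CommRing R]

/-- Blocks labelled by a ring `R`, and vectors whose `R`-multiples fill `R ^ k`, give a labelling
by `R ^ k`. -/
theorem IsLabelling.sum_smul {T : Type*} {h : (T → ZMod 2) → R} (hh : IsLabelling h) {k : ℕ}
    (V : Finset (Fin k → R)) (hV : ∀ d : Fin k → R, ∃ v ∈ V, ∃ r : R, r • v = d) :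
    IsLabelling (fun x : (V × T → ZMod 2) => ∑ v : V, h (fun t => x (v, t)) • v.1) := by
  classical
  intro x g
  obtain ⟨v, hv, r, hr⟩ := hV (g - ∑ v : V, h (fun t => x (v, t)) • v.1)
  -- One letter changed inside block `v` raises the label of that block by `r`, hence the total by
  -- `r • v`, the missing difference.
  obtain ⟨y, hy, hyr⟩ := hh (fun t => x (⟨v, hv⟩, t)) (h (fun t => x (⟨v, hv⟩, t)) + r)
  refine ⟨fun p => if p.1 = ⟨v, hv⟩ then y p.2 else x p, ?_, ?_⟩
  · rintro ⟨w, t⟩ ⟨w', t'⟩ h1 h2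
    by_cases hw : w = ⟨v, hv⟩
    · by_cases hw' : w' = ⟨v, hv⟩
      · subst hw hw'
        rw [hy t t' (by simpa using h1) (by simpa using h2)]
      · simp [hw'] at h2
    · simp [hw] at h1
  · have : ∀ w : V, h (fun t => if w = ⟨v, hv⟩ then y t else x (w, t)) • w.1
        = h (fun t => x (w, t)) • w.1 + if w = ⟨v, hv⟩ then r • v else 0 := by
      intro w
      by_cases hw : w = ⟨v, hv⟩
      · subst hw
        simp [hyr, add_smul]
      · simp [hw]
    simp only [this, Finset.sum_add_distrib]
    simp [hr]

/-- Few vectors whose multiples fill `R ^ k`. -/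
theorem exists_smul_cover [Fintype R] [Fintype Rˣ] (k : ℕ) :
    ∃ V : Finset (Fin k → R), (∀ d : Fin k → R, ∃ v ∈ V, ∃ r : R, r • v = d) ∧
      V.card * Fintype.card Rˣ ≤ Fintype.card R ^ k +
        Fintype.card R * (Fintype.card R - Fintype.card Rˣ) ^ k := by
  classical
  -- `V₁` holds the vectors normalised so that their first unit entry is `1`; unit multiples of
  -- distinct members are distinct, which bounds its size. Vectors without a unit entry are rare and
  -- are all kept, in `V₂`.
  let V₁ : Finset (Fin k → R) :=
    Finset.univ.filter fun v => ∃ i, v i = 1 ∧ ∀ j < i, ¬ IsUnit (v j)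
  let V₂ : Finset (Fin k → R) := Fintype.piFinset fun _ => Finset.univ.filter fun r => ¬ IsUnit r
  have hU : (Finset.univ.filter fun r : R => IsUnit r).card = Fintype.card Rˣ := by
    rw [← Finset.card_univ, ← Finset.card_image_of_injective (f := ((↑) : Rˣ → R)) _
      Units.val_injective]
    congr 1
    ext r
    simp only [Finset.mem_filter, Finset.mem_image, Finset.mem_univ, true_and]
    exact Iff.rfl
  have hN : (Finset.univ.filter fun r : R => ¬ IsUnit r).card
      = Fintype.card R - Fintype.card Rˣ := by
    rw [← hU, Finset.filter_not, Finset.card_sdiff_of_subset (Finset.subset_univ _),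
      Finset.card_univ]
  have h₂ : V₂.card = (Fintype.card R - Fintype.card Rˣ) ^ k := by
    simp [V₂, hN]
  have h₁ : V₁.card * Fintype.card Rˣ ≤ Fintype.card R ^ k := by
    have : (V₁ ×ˢ (Finset.univ : Finset Rˣ)).card ≤ (Finset.univ : Finset (Fin k → R)).card := by
      refine Finset.card_le_card_of_injOn (fun p => p.2 • p.1) (fun _ _ => Finset.mem_univ _) ?_
      rintro ⟨v, a⟩ hv ⟨w, b⟩ hw hvw
      simp only [Finset.coe_product, Set.mem_prod, Finset.mem_coe, V₁, Finset.mem_filter,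
        Finset.mem_univ, true_and, and_true, Finset.coe_univ, Set.mem_univ] at hv hw
      obtain ⟨i, hi, hi'⟩ := hv
      obtain ⟨j, hj, hj'⟩ := hw
      have hvw' : ∀ l, (a : R) * v l = b * w l := fun l => by
        simpa [Units.smul_def] using congrFun hvw l
      have hu : ∀ l, IsUnit (v l) ↔ IsUnit (w l) := fun l => by
        rw [← Units.isUnit_units_mul a (v l), hvw' l, Units.isUnit_units_mul]
      have hij : i = j := by
        rcases lt_trichotomy i j with h | h | h
        · exact absurd ((hu i).1 (by simp [hi])) (hj' i h)
        · exact h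
        · exact absurd ((hu j).2 (by simp [hj])) (hi' j h)
      subst hij
      have hab : a = b := Units.ext (by simpa [hi, hj] using hvw' i)
      subst hab
      refine Prod.ext (funext fun l => ?_) rfl
      simpa using hvw' l
    simpa using this
  refine ⟨V₁ ∪ V₂, ?_, ?_⟩
  · intro d
    by_cases hd : ∃ i, IsUnit (d i)
    · have hmin := Finset.exists_minimal (s := Finset.univ.filter fun i => IsUnit (d i))
        (by obtain ⟨i, hi⟩ := hd; exact ⟨i, by simp [hi]⟩)
      obtain ⟨i, hi, hmin⟩ := hmin
      simp only [Finset.mem_filter, Finset.mem_univ, true_and] at hi hmin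
      obtain ⟨u, hu⟩ := hi
      refine ⟨fun l => (↑u⁻¹ : R) * d l, Finset.mem_union_left _ ?_, u, ?_⟩
      · simp only [V₁, Finset.mem_filter, Finset.mem_univ, true_and]
        refine ⟨i, by simp [← hu], fun j hj hju => ?_⟩
        rw [Units.isUnit_units_mul] at hju
        exact absurd (hmin hju hj.le) (not_le.2 hj)
      · funext l
        simp
    · push Not at hd
      refine ⟨d, Finset.mem_union_right _ ?_, 1, one_smul _ _⟩
      simpa [V₂] using hd
  · have hle : Fintype.card Rˣ ≤ Fintype.card R :=
      Fintype.card_le_of_injective _ Units.val_injective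
    calc (V₁ ∪ V₂).card * Fintype.card Rˣ
        ≤ (V₁.card + V₂.card) * Fintype.card Rˣ :=
          Nat.mul_le_mul_right _ (Finset.card_union_le _ _)
      _ = V₁.card * Fintype.card Rˣ + Fintype.card Rˣ * V₂.card := by ring
      _ ≤ _ := by
          rw [h₂]
          exact add_le_add h₁ (Nat.mul_le_mul_right _ hle)

end RingCode

/-- Since `|R| ≤ 2 ^ s`, the Hamming labels map onto `R`, so blocks of length `2 ^ s - 1` carry
labels in `R`, one block for each vector of the cover. -/
theorem exists_hasLabelling_ring (R : Type) [CommRing R] [Fintype R] [Fintype Rˣ] (s k a : ℕ)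
    (hs : Fintype.card R ≤ 2 ^ s) :
    ∃ m : ℕ, m * Fintype.card Rˣ ≤ Fintype.card R ^ k +
        Fintype.card R * (Fintype.card R - Fintype.card Rˣ) ^ k ∧
      HasLabelling (2 ^ a * (m * (2 ^ s - 1) + 1) - 1) (2 ^ a * Fintype.card R ^ k) := by
  classical
  obtain ⟨V, hV, hcard⟩ := exists_smul_cover (R := R) k
  refine ⟨V.card, hcard, ?_⟩
  have hT : Fintype.card (Fin s → ZMod 2) = 2 ^ s := by simp [ZMod.card]
  obtain ⟨e⟩ := Function.Embedding.nonempty_of_card_le (hs.trans_eq hT.symm)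
  have h := ((((isLabelling_hamming s).comp_surjective
    (Function.invFun_surjective e.injective)).sum_smul V hV).hasLabelling).double_iterate a
  simpa [Fintype.card_prod, Fintype.card_subtype_compl, ZMod.card] using h

/-! ### Prime counts: Selberg's upper bound sieve and Chebyshev's lower bound. -/

open ArithmeticFunction in
theorem sum_moebius_div_between {l m z : ℕ} (hl : l ≠ 0) (hm : m ∈ Finset.Icc 1 z) :
    ∑ d ∈ (Finset.Icc 1 z).filter (fun d => l ∣ d ∧ d ∣ m), (moebius (m / d) : ℝ)
      = if m = l then 1 else 0 := by
  rw [Finset.mem_Icc] at hm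
  by_cases hlm : l ∣ m
  · obtain ⟨q, rfl⟩ := hlm
    have hq : q ≠ 0 := by rintro rfl; simp at hm
    have h1 : ∑ d ∈ (Finset.Icc 1 z).filter (fun d => l ∣ d ∧ d ∣ l * q),
        (moebius (l * q / d) : ℝ) = ∑ e ∈ q.divisors, (moebius (q / e) : ℝ) := by
      symm
      refine Finset.sum_bij (fun e _ => l * e) ?_ ?_ ?_ ?_
      · intro e he
        have he' := Nat.dvd_of_mem_divisors he
        have : l * e ∣ l * q := Nat.mul_dvd_mul_left l he'
        have h2 := Nat.le_of_dvd (by omega) this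
        have h3 : l * e ≠ 0 := mul_ne_zero hl (fun h => hq (by simpa [h] using he'))
        simp only [Finset.mem_filter, Finset.mem_Icc]
        exact ⟨⟨by omega, by omega⟩, dvd_mul_right _ _, this⟩
      · intro e _ e' _ h
        exact Nat.eq_of_mul_eq_mul_left (Nat.pos_of_ne_zero hl) h
      · intro d hd
        simp only [Finset.mem_filter, Finset.mem_Icc] at hd
        obtain ⟨-, ⟨e, rfl⟩, hdm⟩ := hd
        exact ⟨e, Nat.mem_divisors.2 ⟨Nat.dvd_of_mul_dvd_mul_left (Nat.pos_of_ne_zero hl) hdm, hq⟩,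
          rfl⟩
      · intro e _
        rw [Nat.mul_div_mul_left _ _ (Nat.pos_of_ne_zero hl)]
    rw [h1, Nat.sum_div_divisors q (fun e => (moebius e : ℝ))]
    have h2 : (∑ e ∈ q.divisors, moebius e) = if q = 1 then 1 else 0 := by
      rw [← ArithmeticFunction.coe_zeta_mul_apply, ArithmeticFunction.coe_zeta_mul_moebius,
        ArithmeticFunction.one_apply]
    have h3 : l * q = l ↔ q = 1 := by
      constructor
      · intro h
        exact Nat.eq_of_mul_eq_mul_left (Nat.pos_of_ne_zero hl) (by simpa using h)
      · rintro rfl; simp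
    rw [← Int.cast_sum, h2]
    simp [h3]
  · rw [if_neg (fun h => hlm (by rw [h])), Finset.sum_eq_zero]
    intro d hd
    simp only [Finset.mem_filter] at hd
    exact absurd (hd.2.1.trans hd.2.2) hlm

theorem abs_card_filter_dvd_Ioc_sub_le (x h k : ℕ) (hk : k ≠ 0) :
    |(((Finset.Ioc x (x + h)).filter (k ∣ ·)).card : ℝ) - h / k| ≤ 1 := by
  have hcard : (((Finset.Ioc x (x + h)).filter (k ∣ ·)).card : ℝ)
      = ((x + h) / k : ℕ) - (x / k : ℕ) := by
    have h1 := Nat.Ioc_filter_dvd_card_eq_div (x + h) k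
    have h2 := Nat.Ioc_filter_dvd_card_eq_div x k
    have hu : Finset.Ioc 0 x ∪ Finset.Ioc x (x + h) = Finset.Ioc 0 (x + h) :=
      Finset.Ioc_union_Ioc_eq_Ioc (Nat.zero_le _) (Nat.le_add_right _ _)
    rw [← hu, Finset.filter_union, Finset.card_union_of_disjoint, h2] at h1
    · rw [← h1]; push_cast; ring
    · exact Finset.disjoint_filter_filter (Finset.Ioc_disjoint_Ioc_of_le le_rfl)
  have hk' : (0 : ℝ) < k := by positivity
  have key : ∀ y : ℕ, ((y / k : ℕ) : ℝ) ≤ y / k ∧ (y : ℝ) / k - 1 ≤ (y / k : ℕ) := by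
    intro y
    have h1 : (k : ℝ) * (y / k : ℕ) + (y % k : ℕ) = y := by exact_mod_cast Nat.div_add_mod y k
    have h2 : ((y % k : ℕ) : ℝ) ≤ k := by
      exact_mod_cast (Nat.mod_lt y (Nat.pos_of_ne_zero hk)).le
    have h3 : (0 : ℝ) ≤ (y % k : ℕ) := Nat.cast_nonneg _
    constructor
    · rw [le_div_iff₀ hk']; linarith
    · rw [sub_le_iff_le_add, div_le_iff₀ hk']; linarith
  obtain ⟨a1, a2⟩ := key (x + h)
  obtain ⟨b1, b2⟩ := key x
  have e : ((x + h : ℕ) : ℝ) / k = x / k + h / k := by push_cast; ring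
  rw [hcard, abs_le]
  constructor <;> linarith

/-- `∑ 1 / l` over the squarefree `l ≤ z`. -/
noncomputable def squarefreeSum (z : ℕ) : ℝ :=
  ∑ l ∈ Finset.Icc 1 z, (ArithmeticFunction.moebius l : ℝ) ^ 2 / l

theorem moebius_sq_cast_eq (l : ℕ) :
    (ArithmeticFunction.moebius l : ℝ) ^ 2 = if Squarefree l then 1 else 0 := by
  split_ifs with h
  · exact_mod_cast ArithmeticFunction.moebius_sq_eq_one_of_squarefree h
  · simp [ArithmeticFunction.moebius_eq_zero_of_not_squarefree h]

/-- Every integer is a square times a squarefree number, so the harmonic sum is at most the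
squarefree sum times `∑ 1 / b ^ 2 ≤ 2`. -/
theorem log_le_two_mul_squarefreeSum (z : ℕ) : Real.log (z + 1) ≤ 2 * squarefreeSum z := by
  have hterm : ∀ n ∈ Finset.Icc 1 z, ((n : ℝ))⁻¹ ≤ ∑ p ∈ (Finset.Icc 1 z ×ˢ Finset.Icc 1 z).filter
      (fun p => p.2 ^ 2 * p.1 = n),
        (ArithmeticFunction.moebius p.1 : ℝ) ^ 2 / p.1 * ((p.2 : ℝ) ^ 2)⁻¹ := by
    intro n hn
    rw [Finset.mem_Icc] at hn
    obtain ⟨a, b, ha, hb, hab, hs⟩ := Nat.sq_mul_squarefree_of_pos hn.1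
    have hab' : a ≤ n := by rw [← hab]; exact Nat.le_mul_of_pos_left _ (by positivity)
    have hbb : b ≤ n := by
      rw [← hab, sq, mul_assoc]; exact Nat.le_mul_of_pos_right _ (by positivity)
    refine le_trans (le_of_eq ?_) (Finset.single_le_sum
      (f := fun p : ℕ × ℕ => (ArithmeticFunction.moebius p.1 : ℝ) ^ 2 / p.1 * ((p.2 : ℝ) ^ 2)⁻¹)
      (fun p _ => by positivity) (a := (a, b)) ?_)
    · simp only [moebius_sq_cast_eq, hs, if_true]
      rw [← hab]
      push_cast
      rw [mul_inv, one_div, mul_comm]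
    · simp only [Finset.mem_filter, Finset.mem_product, Finset.mem_Icc]
      omega
  have h1 : Real.log (z + 1) ≤ ∑ n ∈ Finset.Icc 1 z, ((n : ℝ))⁻¹ := by
    have := log_add_one_le_harmonic z
    rw [harmonic_eq_sum_Icc] at this
    push_cast at this
    exact this
  have h2 : ∑ b ∈ Finset.Icc 1 z, ((b : ℝ) ^ 2)⁻¹ ≤ 2 := by
    have := sum_Ioo_inv_sq_le (α := ℝ) 0 (z + 1)
    have e : Finset.Ioo 0 (z + 1) = Finset.Icc 1 z := by ext; simp; omega
    rw [e] at this
    simpa using this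
  have h0 : 0 ≤ squarefreeSum z := Finset.sum_nonneg fun _ _ => by positivity
  calc Real.log (z + 1) ≤ ∑ n ∈ Finset.Icc 1 z, ((n : ℝ))⁻¹ := h1
    _ ≤ ∑ n ∈ Finset.Icc 1 z, ∑ p ∈ (Finset.Icc 1 z ×ˢ Finset.Icc 1 z).filter
      (fun p => p.2 ^ 2 * p.1 = n),
        (ArithmeticFunction.moebius p.1 : ℝ) ^ 2 / p.1 * ((p.2 : ℝ) ^ 2)⁻¹ := Finset.sum_le_sum hterm
    _ ≤ ∑ p ∈ Finset.Icc 1 z ×ˢ Finset.Icc 1 z,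
        (ArithmeticFunction.moebius p.1 : ℝ) ^ 2 / p.1 * ((p.2 : ℝ) ^ 2)⁻¹ :=
      Finset.sum_fiberwise_le_sum_of_sum_fiber_nonneg fun _ _ =>
        Finset.sum_nonneg fun _ _ => by positivity
    _ = squarefreeSum z * ∑ b ∈ Finset.Icc 1 z, ((b : ℝ) ^ 2)⁻¹ := by
      rw [squarefreeSum, Finset.sum_mul_sum, Finset.sum_product]
    _ ≤ 2 * squarefreeSum z := by nlinarith

/-- Dual Möbius inversion on `{1, …, z}`. -/
theorem exists_sum_multiples_eq (z : ℕ) (a : ℕ → ℝ) :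
    ∃ b : ℕ → ℝ, (∀ l ∈ Finset.Icc 1 z, ∑ d ∈ (Finset.Icc 1 z).filter (l ∣ ·), b d = a l) ∧
      b 1 = ∑ m ∈ Finset.Icc 1 z, (ArithmeticFunction.moebius m : ℝ) * a m ∧
      ∀ d, |b d| ≤ ∑ m ∈ Finset.Icc 1 z, |a m| := by
  refine ⟨fun d => ∑ m ∈ (Finset.Icc 1 z).filter (d ∣ ·),
    (ArithmeticFunction.moebius (m / d) : ℝ) * a m, ?_, ?_, ?_⟩
  · intro l hl
    have hl0 : l ≠ 0 := by rw [Finset.mem_Icc] at hl; omega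
    calc ∑ d ∈ (Finset.Icc 1 z).filter (l ∣ ·), ∑ m ∈ (Finset.Icc 1 z).filter (d ∣ ·),
          (ArithmeticFunction.moebius (m / d) : ℝ) * a m
        = ∑ m ∈ Finset.Icc 1 z, ∑ d ∈ (Finset.Icc 1 z).filter (fun d => l ∣ d ∧ d ∣ m),
          (ArithmeticFunction.moebius (m / d) : ℝ) * a m := by
          refine Finset.sum_comm' fun d m => ?_
          simp only [Finset.mem_filter]
          tauto
      _ = ∑ m ∈ Finset.Icc 1 z, (if m = l then 1 else 0) * a m := by
          refine Finset.sum_congr rfl fun m hm => ?_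
          rw [← Finset.sum_mul, sum_moebius_div_between hl0 hm]
      _ = a l := by simp [Finset.mem_Icc.1 hl]
  · simp
  · intro d
    refine (Finset.abs_sum_le_sum_abs _ _).trans ?_
    refine (Finset.sum_le_sum_of_subset_of_nonneg (Finset.filter_subset _ _)
      fun _ _ _ => abs_nonneg _).trans (Finset.sum_le_sum fun m _ => ?_)
    rw [abs_mul]
    refine mul_le_of_le_one_left (abs_nonneg _) ?_
    exact_mod_cast ArithmeticFunction.abs_moebius_le_one

/-- Writing the gcd as the sum of `φ` over the common divisors diagonalises the quadratic form of
the sieve. -/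
theorem sum_sum_mul_gcd (z : ℕ) (b : ℕ → ℝ) :
    ∑ d ∈ Finset.Icc 1 z, ∑ e ∈ Finset.Icc 1 z, b d * b e * (Nat.gcd d e : ℝ)
      = ∑ l ∈ Finset.Icc 1 z, (Nat.totient l : ℝ) *
          (∑ d ∈ (Finset.Icc 1 z).filter (l ∣ ·), b d) ^ 2 := by
  have h1 : ∀ d ∈ Finset.Icc 1 z, ∀ e ∈ Finset.Icc 1 z, (Nat.gcd d e : ℝ)
      = ∑ l ∈ Finset.Icc 1 z, (Nat.totient l : ℝ) * ((if l ∣ d then 1 else 0) *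
          (if l ∣ e then 1 else 0)) := by
    intro d hd e he
    rw [Finset.mem_Icc] at hd he
    have hg : Nat.gcd d e ≠ 0 := Nat.gcd_ne_zero_left (by omega)
    have hsub : (Nat.gcd d e).divisors ⊆ Finset.Icc 1 z := by
      intro l hl
      have h2 := Nat.dvd_of_mem_divisors hl
      have h3 := Nat.le_of_dvd (by omega) (h2.trans (Nat.gcd_dvd_left d e))
      have h4 := Nat.pos_of_mem_divisors hl
      simp; omega
    rw [← Finset.sum_subset hsub]
    · have h5 : (Nat.gcd d e : ℝ) = ∑ l ∈ (Nat.gcd d e).divisors, (Nat.totient l : ℝ) := by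
        exact_mod_cast (Nat.sum_totient (Nat.gcd d e)).symm
      refine h5.trans ?_
      refine Finset.sum_congr rfl fun l hl => ?_
      have h2 := Nat.dvd_gcd_iff.1 (Nat.dvd_of_mem_divisors hl)
      simp [h2]
    · intro l _ hl
      have : ¬ (l ∣ d ∧ l ∣ e) := fun h =>
        hl (Nat.mem_divisors.2 ⟨Nat.dvd_gcd_iff.2 h, hg⟩)
      by_cases h : l ∣ d <;> simp_all
  calc _ = ∑ d ∈ Finset.Icc 1 z, ∑ e ∈ Finset.Icc 1 z, ∑ l ∈ Finset.Icc 1 z,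
        (Nat.totient l : ℝ) * ((if l ∣ d then b d else 0) * (if l ∣ e then b e else 0)) := by
        refine Finset.sum_congr rfl fun d hd => Finset.sum_congr rfl fun e he => ?_
        rw [h1 d hd e he, Finset.mul_sum]
        refine Finset.sum_congr rfl fun l _ => ?_
        split_ifs <;> ring
    _ = ∑ l ∈ Finset.Icc 1 z, ∑ d ∈ Finset.Icc 1 z, ∑ e ∈ Finset.Icc 1 z,
        (Nat.totient l : ℝ) * ((if l ∣ d then b d else 0) * (if l ∣ e then b e else 0)) := by
        rw [Finset.sum_comm, Finset.sum_congr rfl fun d _ => Finset.sum_comm, Finset.sum_comm]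
        exact Finset.sum_congr rfl fun l _ => Finset.sum_comm
    _ = _ := by
        refine Finset.sum_congr rfl fun l _ => ?_
        rw [sq, Finset.sum_filter, Finset.sum_mul_sum, Finset.mul_sum]
        exact Finset.sum_congr rfl fun d _ => by rw [Finset.mul_sum]

/-- Selberg's sieve for the primes in an interval. -/
theorem card_primes_Ioc_le (x h z : ℕ) (hz : 1 ≤ z) (hx : z ≤ x) :
    (((Finset.Ioc x (x + h)).filter Nat.Prime).card : ℝ) ≤ h / squarefreeSum z + z ^ 4 := by
  set S := squarefreeSum z with hS
  have hS0 : 0 < S := by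
    have := log_le_two_mul_squarefreeSum z
    have h2 : 0 < Real.log (z + 1) := Real.log_pos (by
      have : (1 : ℝ) ≤ z := by exact_mod_cast hz
      linarith)
    linarith
  -- The sieve weights are `d * b d`. This choice of diagonal coordinates minimises the form with
  -- `φ(l)` replaced by its bound `l`, subject to `b 1 = 1`.
  obtain ⟨b, hb, hb1, hbabs⟩ := exists_sum_multiples_eq z
    (fun m => (ArithmeticFunction.moebius m : ℝ) / (m * S))
  have hb1' : b 1 = 1 := by
    rw [hb1]
    have : ∀ m ∈ Finset.Icc 1 z, (ArithmeticFunction.moebius m : ℝ) *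
        ((ArithmeticFunction.moebius m : ℝ) / (m * S))
        = (ArithmeticFunction.moebius m : ℝ) ^ 2 / m / S := fun m _ => by
      rw [div_div, sq, mul_div_assoc]
    rw [Finset.sum_congr rfl this, ← Finset.sum_div]
    exact div_self hS0.ne'
  have habs : ∀ d, |b d| ≤ 1 := by
    intro d
    refine (hbabs d).trans (le_of_eq ?_)
    have : ∀ m ∈ Finset.Icc 1 z, |(ArithmeticFunction.moebius m : ℝ) / (m * S)|
        = (ArithmeticFunction.moebius m : ℝ) ^ 2 / m / S := fun m _ => by
      rw [abs_div, abs_of_nonneg (by positivity : 0 ≤ (m : ℝ) * S), div_div]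
      congr 1
      rcases ArithmeticFunction.moebius_eq_or m with h | h | h <;> simp [h]
    rw [Finset.sum_congr rfl this, ← Finset.sum_div]
    exact div_self hS0.ne'
  -- As `z ≤ x`, a prime beyond `x` has no divisor in `[1, z]` except `1`, so its weight is exactly
  -- one.
  have hprime : ∀ n ∈ (Finset.Ioc x (x + h)).filter Nat.Prime,
      (∑ d ∈ (Finset.Icc 1 z).filter (· ∣ n), d * b d) ^ 2 = 1 := by
    intro n hn
    rw [Finset.mem_filter, Finset.mem_Ioc] at hn
    have : (Finset.Icc 1 z).filter (· ∣ n) = {1} := by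
      ext d
      simp only [Finset.mem_filter, Finset.mem_Icc, Finset.mem_singleton]
      constructor
      · rintro ⟨h1, h2⟩
        rcases (Nat.dvd_prime hn.2).1 h2 with h | h <;> omega
      · rintro rfl
        simpa using hz
    simp [this, hb1']
  have hform : ∑ d ∈ Finset.Icc 1 z, ∑ e ∈ Finset.Icc 1 z, b d * b e * (Nat.gcd d e : ℝ)
      ≤ 1 / S := by
    rw [sum_sum_mul_gcd]
    calc _ ≤ ∑ l ∈ Finset.Icc 1 z, (ArithmeticFunction.moebius l : ℝ) ^ 2 / l / (S ^ 2) := by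
          refine Finset.sum_le_sum fun l hl => ?_
          rw [hb l hl]
          have hl0 : (0 : ℝ) < l := by
            rw [Finset.mem_Icc] at hl
            exact_mod_cast hl.1
          have : (Nat.totient l : ℝ) ≤ l := by exact_mod_cast Nat.totient_le l
          calc (Nat.totient l : ℝ) * ((ArithmeticFunction.moebius l : ℝ) / (l * S)) ^ 2
              ≤ l * ((ArithmeticFunction.moebius l : ℝ) / (l * S)) ^ 2 := by gcongr
            _ = _ := by field_simp
      _ = 1 / S := by
          rw [← Finset.sum_div]
          change S / S ^ 2 = 1 / S
          field_simp
  -- The weights are bounded only by `z`, so each of the `z ^ 2` pairs costs an error `z ^ 2`; this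
  -- is the term `z ^ 4`.
  have hpair : ∀ d ∈ Finset.Icc 1 z, ∀ e ∈ Finset.Icc 1 z,
      (d * b d) * (e * b e) * (((Finset.Ioc x (x + h)).filter (Nat.lcm d e ∣ ·)).card : ℝ)
        ≤ h * (b d * b e * (Nat.gcd d e : ℝ)) + z ^ 2 := by
    intro d hd e he
    rw [Finset.mem_Icc] at hd he
    have hl0 : Nat.lcm d e ≠ 0 := Nat.lcm_ne_zero (by omega) (by omega)
    have h1 := abs_card_filter_dvd_Ioc_sub_le x h _ hl0
    set c : ℝ := (((Finset.Ioc x (x + h)).filter (Nat.lcm d e ∣ ·)).card : ℝ)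
    have hgl : (Nat.gcd d e : ℝ) * Nat.lcm d e = d * e := by exact_mod_cast Nat.gcd_mul_lcm d e
    have hl0' : (Nat.lcm d e : ℝ) ≠ 0 := by exact_mod_cast hl0
    have h2 : (d * b d) * (e * b e) * ((h : ℝ) / Nat.lcm d e)
        = h * (b d * b e * (Nat.gcd d e : ℝ)) := by
      field_simp
      linear_combination (- b d * b e * h) * hgl
    have hdz : (d : ℝ) ≤ z := by exact_mod_cast hd.2
    have hez : (e : ℝ) ≤ z := by exact_mod_cast he.2
    have h3 : (d * b d) * (e * b e) * (c - h / Nat.lcm d e) ≤ z ^ 2 := by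
      refine (le_abs_self _).trans ?_
      rw [abs_mul, abs_mul, abs_mul, abs_mul, Nat.abs_cast, Nat.abs_cast]
      calc (d * |b d|) * (e * |b e|) * |c - h / Nat.lcm d e| ≤ (z * 1) * (z * 1) * 1 := by
            gcongr
            · exact habs d
            · exact habs e
        _ = z ^ 2 := by ring
    linarith
  calc (((Finset.Ioc x (x + h)).filter Nat.Prime).card : ℝ)
      = ∑ n ∈ (Finset.Ioc x (x + h)).filter Nat.Prime,
          (∑ d ∈ (Finset.Icc 1 z).filter (· ∣ n), d * b d) ^ 2 := by
        rw [Finset.sum_congr rfl hprime]; simp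
    _ ≤ ∑ n ∈ Finset.Ioc x (x + h), (∑ d ∈ (Finset.Icc 1 z).filter (· ∣ n), d * b d) ^ 2 :=
        Finset.sum_le_sum_of_subset_of_nonneg (Finset.filter_subset _ _) fun _ _ _ => sq_nonneg _
    _ = ∑ n ∈ Finset.Ioc x (x + h), ∑ d ∈ Finset.Icc 1 z, ∑ e ∈ Finset.Icc 1 z,
          (d * b d) * (e * b e) * (if Nat.lcm d e ∣ n then 1 else 0) := by
        refine Finset.sum_congr rfl fun n _ => ?_
        rw [sq, Finset.sum_filter, Finset.sum_mul_sum]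
        refine Finset.sum_congr rfl fun d _ => Finset.sum_congr rfl fun e _ => ?_
        by_cases h1 : d ∣ n <;> by_cases h2 : e ∣ n <;> simp [Nat.lcm_dvd_iff, h1, h2]
    _ = ∑ d ∈ Finset.Icc 1 z, ∑ e ∈ Finset.Icc 1 z, ∑ n ∈ Finset.Ioc x (x + h),
          (d * b d) * (e * b e) * (if Nat.lcm d e ∣ n then 1 else 0) := by
        rw [Finset.sum_comm]
        exact Finset.sum_congr rfl fun d _ => Finset.sum_comm
    _ = ∑ d ∈ Finset.Icc 1 z, ∑ e ∈ Finset.Icc 1 z, (d * b d) * (e * b e) *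
          (((Finset.Ioc x (x + h)).filter (Nat.lcm d e ∣ ·)).card : ℝ) := by
        refine Finset.sum_congr rfl fun d _ => Finset.sum_congr rfl fun e _ => ?_
        rw [← Finset.mul_sum, Finset.sum_boole]
    _ ≤ ∑ d ∈ Finset.Icc 1 z, ∑ e ∈ Finset.Icc 1 z,
          ((h : ℝ) * (b d * b e * (Nat.gcd d e : ℝ)) + (z : ℝ) ^ 2) :=
        Finset.sum_le_sum fun d hd => Finset.sum_le_sum fun e he => hpair d hd e he
    _ = h * (∑ d ∈ Finset.Icc 1 z, ∑ e ∈ Finset.Icc 1 z, b d * b e * (Nat.gcd d e : ℝ))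
          + z ^ 4 := by
        simp only [Finset.sum_add_distrib, Finset.mul_sum]
        simp
        ring
    _ ≤ h * (1 / S) + z ^ 4 := by gcongr
    _ = h / S + z ^ 4 := by ring

/-- Chebyshev's lower bound for the primes between consecutive powers of `4`. -/
theorem eventually_four_pow_le_card_primes :
    ∀ᶠ j : ℕ in Filter.atTop,
      (4 : ℝ) ^ j ≤ 2 * (j + 1) * (((Finset.Ioc (4 ^ j) (4 ^ (j + 1))).filter Nat.Prime).card : ℝ) := by
  have hlim : ∀ᶠ j : ℕ in Filter.atTop, ((j : ℝ) + 2) * 4 * 2 ^ j ≤ (1 / 16) * 4 ^ j := by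
    have h1 : Filter.Tendsto (fun j : ℕ => (j : ℝ) ^ 1 * (1 / 2 : ℝ) ^ j) Filter.atTop (nhds 0) :=
      tendsto_pow_const_mul_const_pow_of_lt_one 1 (by norm_num) (by norm_num)
    have h2 : Filter.Tendsto (fun j : ℕ => (1 / 2 : ℝ) ^ j) Filter.atTop (nhds 0) :=
      tendsto_pow_atTop_nhds_zero_of_lt_one (by norm_num) (by norm_num)
    filter_upwards [h1.eventually_le_const (show (0 : ℝ) < 1 / 256 by norm_num),
      h2.eventually_le_const (show (0 : ℝ) < 1 / 512 by norm_num)] with j a b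
    have e : (4 : ℝ) ^ j = 2 ^ j * 2 ^ j := by rw [← mul_pow]; norm_num
    have e2 : (1 / 2 : ℝ) ^ j * 2 ^ j = 1 := by rw [← mul_pow]; norm_num
    have hp : (0 : ℝ) < 2 ^ j := by positivity
    have a' : (j : ℝ) ≤ 1 / 256 * 2 ^ j := by
      calc (j : ℝ) = (j : ℝ) ^ 1 * (1 / 2 : ℝ) ^ j * 2 ^ j := by rw [mul_assoc, e2]; ring
        _ ≤ _ := by gcongr
    have b' : (1 : ℝ) ≤ 1 / 512 * 2 ^ j := by
      calc (1 : ℝ) = (1 / 2 : ℝ) ^ j * 2 ^ j := e2.symm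
        _ ≤ _ := by gcongr
    rw [e]
    nlinarith
  filter_upwards [hlim] with j hj
  have hlog4 : Real.log 4 = 2 * Real.log 2 := by
    rw [show (4 : ℝ) = 2 ^ 2 by norm_num, Real.log_pow]; norm_num
  have hl1 := Real.log_two_gt_d9
  have hl2 := Real.log_two_lt_d9
  -- With `X = 4 ^ j`, the lower main term `4 X log 2` is twice the upper bound `X log 4`. For
  -- intervals of ratio 2 the two would cancel, hence powers of `4`.
  have hlow := Chebyshev.theta_ge (4 ^ (j + 1))
  have hup := Chebyshev.theta_le_log4_mul_x (x := (4 ^ j : ℕ)) (by positivity)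
  have hdiff : Chebyshev.theta (4 ^ (j + 1) : ℕ) - Chebyshev.theta (4 ^ j : ℕ)
      = ∑ p ∈ (Finset.Ioc (4 ^ j) (4 ^ (j + 1))).filter Nat.Prime, Real.log p := by
    rw [Chebyshev.theta, Chebyshev.theta, Nat.floor_natCast, Nat.floor_natCast, sub_eq_iff_eq_add,
      ← Finset.sum_union]
    · rw [← Finset.filter_union, Finset.union_comm, Finset.Ioc_union_Ioc_eq_Ioc (Nat.zero_le _)]
      exact Nat.pow_le_pow_right (by norm_num) (Nat.le_succ j)
    · exact Finset.disjoint_filter_filter (Finset.Ioc_disjoint_Ioc_of_le le_rfl).symm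
  have hcount : ∑ p ∈ (Finset.Ioc (4 ^ j) (4 ^ (j + 1))).filter Nat.Prime, Real.log p
      ≤ (((Finset.Ioc (4 ^ j) (4 ^ (j + 1))).filter Nat.Prime).card : ℝ) * ((j + 1) * Real.log 4) := by
    rw [← nsmul_eq_mul]
    refine Finset.sum_le_card_nsmul _ _ _ fun p hp => ?_
    simp only [Finset.mem_filter, Finset.mem_Ioc] at hp
    have h1 : (p : ℝ) ≤ 4 ^ (j + 1) := by exact_mod_cast hp.1.2
    have h2 : (0 : ℝ) < p := by exact_mod_cast hp.2.pos
    have := Real.log_le_log h2 h1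
    rw [Real.log_pow] at this
    exact_mod_cast this
  set c : ℝ := (((Finset.Ioc (4 ^ j) (4 ^ (j + 1))).filter Nat.Prime).card : ℝ)
  have hc0 : 0 ≤ c := Nat.cast_nonneg _
  have hsqrt : Real.sqrt ((4 ^ (j + 1) : ℕ) : ℝ) = 2 * 2 ^ j := by
    rw [show ((4 ^ (j + 1) : ℕ) : ℝ) = (2 * 2 ^ j) ^ 2 by
      push_cast; rw [mul_pow, ← pow_mul, mul_comm j 2, pow_mul, pow_succ]; norm_num; ring]
    exact Real.sqrt_sq (by positivity)
  have hlogp : Real.log ((4 ^ (j + 1) : ℕ) : ℝ) = (j + 1) * (2 * Real.log 2) := by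
    push_cast
    rw [Real.log_pow, hlog4]; push_cast; ring
  have hlogq : Real.log ((4 ^ (j + 1) : ℕ) + 1 : ℝ) ≤ (j + 2) * (2 * Real.log 2) := by
    have : ((4 ^ (j + 1) : ℕ) + 1 : ℝ) ≤ 4 ^ (j + 2) := by
      push_cast
      have : (1 : ℝ) ≤ 4 ^ (j + 1) := one_le_pow₀ (by norm_num)
      rw [pow_succ 4 (j + 1)]; linarith
    refine (Real.log_le_log (by positivity) this).trans ?_
    rw [Real.log_pow, hlog4]; push_cast; linarith
  rw [hsqrt, hlogp] at hlow
  push_cast at hlow hup hlogq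
  rw [hlog4] at hup hcount
  have hp1 : (1 : ℝ) ≤ 2 ^ j := one_le_pow₀ (by norm_num)
  have hj0 : (0 : ℝ) ≤ j := Nat.cast_nonneg j
  have hX : (0 : ℝ) < 4 ^ j := by positivity
  have hpow : (4 : ℝ) ^ (j + 1) = 4 * 4 ^ j := by ring
  rw [hpow] at hlow hlogq
  push_cast at hdiff
  rw [hpow] at hdiff
  have k1 : (j + 2 : ℝ) ≤ (j + 2) * 2 ^ j := le_mul_of_one_le_right (by positivity) hp1
  have k2 : ((j : ℝ) + 1) * 2 ^ j ≤ (j + 2) * 2 ^ j := by gcongr; norm_num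
  have hmain : 4 ^ j * 1 ≤ c * ((j + 1) * (2 * Real.log 2)) := by
    have m1 : Real.log 2 * ((j + 2) * 2 ^ j) ≤ Real.log 2 * (1 / 64 * 4 ^ j) := by
      exact mul_le_mul_of_nonneg_left (by linarith) (by linarith)
    have m2 : Real.log 2 * (j + 2) ≤ Real.log 2 * ((j + 2) * 2 ^ j) := by gcongr
    have m3 : Real.log 2 * ((j + 1) * 2 ^ j) ≤ Real.log 2 * ((j + 2) * 2 ^ j) := by gcongr
    nlinarith
  nlinarith [mul_nonneg hc0 (by positivity : (0 : ℝ) ≤ (j : ℝ) + 1)]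

/-! ### Logarithms of primes modulo `log 4`. -/

/-- The position of `p / 4 ^ j` on a logarithmic scale with `M` steps to the base `4`. -/
noncomputable def logBin (M j p : ℕ) : ℕ :=
  ⌊(M : ℝ) * (Real.log p / Real.log 4 - j)⌋₊

theorem log_four_pos : 0 < Real.log 4 := Real.log_pos (by norm_num)

theorem logBin_bounds {M j p : ℕ} (hp : 4 ^ j < p) :
    (logBin M j p : ℝ) ≤ M * (Real.log p / Real.log 4 - j) ∧
      M * (Real.log p / Real.log 4 - j) < logBin M j p + 1 := by
  have h1 : (j : ℝ) * Real.log 4 ≤ Real.log p := by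
    rw [← Real.log_pow]
    exact Real.log_le_log (by positivity) (by exact_mod_cast hp.le)
  have h2 : 0 ≤ (M : ℝ) * (Real.log p / Real.log 4 - j) := by
    refine mul_nonneg (Nat.cast_nonneg _) (sub_nonneg.2 ?_)
    rwa [le_div_iff₀ log_four_pos]
  exact ⟨Nat.floor_le h2, Nat.lt_floor_add_one _⟩

theorem logBin_le {M j p : ℕ} (hp : 4 ^ j < p) (hp' : p ≤ 4 ^ (j + 1)) : logBin M j p ≤ M := by
  have h0 := (logBin_bounds (M := M) hp).1
  have hp0 : (0 : ℝ) < p := by exact_mod_cast lt_of_le_of_lt (Nat.zero_le _) hp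
  have h1 : Real.log p ≤ (j + 1) * Real.log 4 := by
    have := Real.log_le_log hp0 (show (p : ℝ) ≤ 4 ^ (j + 1) by exact_mod_cast hp')
    rw [Real.log_pow] at this
    exact_mod_cast this
  have h2 : Real.log p / Real.log 4 ≤ j + 1 := by rwa [div_le_iff₀ log_four_pos]
  have : (logBin M j p : ℝ) ≤ M * 1 := h0.trans (by gcongr; linarith)
  exact_mod_cast this.trans_eq (mul_one _)

theorem four_rpow_le {t : ℝ} (h0 : 0 ≤ t) (h1 : t ≤ 1) : (4 : ℝ) ^ t ≤ 1 + 3 * t := by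
  have := rpow_one_add_le_one_add_mul_self (s := 3) (p := t) (by norm_num) h0 h1
  norm_num at this
  linarith

/-- Two members of a bin have ratio at most `4 ^ (1 / M) ≤ 1 + 3 / M`, and `p ≤ 4 * 4 ^ j` turns
this into a bin of length at most `12 * 4 ^ j / M`. -/
theorem le_add_of_logBin_eq {M j p q : ℕ} (hM : 1 ≤ M) (hp : 4 ^ j < p) (hq : 4 ^ j < q)
    (hp' : p ≤ 4 ^ (j + 1)) (h : logBin M j p = logBin M j q) :
    (q : ℝ) ≤ p + 12 * 4 ^ j / M := by
  have hM0 : (0 : ℝ) < M := by exact_mod_cast hM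
  have hp0 : (0 : ℝ) < p := by exact_mod_cast lt_of_le_of_lt (Nat.zero_le _) hp
  have hq0 : (0 : ℝ) < q := by exact_mod_cast lt_of_le_of_lt (Nat.zero_le _) hq
  have h1 := (logBin_bounds (M := M) hp).1
  have h2 := (logBin_bounds (M := M) hq).2
  rw [h] at h1
  have h3 : (M : ℝ) * (Real.log q / Real.log 4 - Real.log p / Real.log 4) ≤ 1 := by linarith
  have h4 : Real.log q ≤ Real.log p + Real.log 4 * (1 / M) := by
    rw [← sub_div, mul_div_assoc', div_le_one log_four_pos] at h3
    rw [mul_one_div, ← sub_le_iff_le_add', le_div_iff₀ hM0]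
    linarith
  have h5 : (q : ℝ) ≤ p * 4 ^ (1 / M : ℝ) := by
    rw [← Real.log_le_log_iff hq0 (by positivity), Real.log_mul hp0.ne' (by positivity),
      Real.log_rpow (by norm_num)]
    linarith
  have h6 : (4 : ℝ) ^ (1 / M : ℝ) ≤ 1 + 3 * (1 / M) :=
    four_rpow_le (by positivity) (by rw [div_le_one hM0]; exact_mod_cast hM)
  have h7 : (p : ℝ) ≤ 4 * 4 ^ j := by
    have : (p : ℝ) ≤ 4 ^ (j + 1) := by exact_mod_cast hp'
    rwa [pow_succ, mul_comm] at this
  calc (q : ℝ) ≤ p * (1 + 3 * (1 / M)) := h5.trans (by gcongr)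
    _ = p + 3 * (1 / M) * p := by ring
    _ ≤ p + 3 * (1 / M) * (4 * 4 ^ j) := by gcongr
    _ = _ := by ring

/-- The sieve at level `M` is applied to the interval containing a bin. The length with rounding is
below `14 * 4 ^ j / M` and is divided by `log M / 2`, which gives `28`; the sieve error, negligible
as `4 ^ j ≥ M ^ 7`, adds `1`. -/
theorem card_filter_logBin_le {M j : ℕ} (hM : 2 ≤ M) (hj : M ^ 7 ≤ 4 ^ j) (b : ℕ) :
    ((((Finset.Ioc (4 ^ j) (4 ^ (j + 1))).filter Nat.Prime).filter
      (fun p => logBin M j p = b)).card : ℝ) ≤ 29 * 4 ^ j / (M * Real.log M) := by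
  have hM0 : (2 : ℝ) ≤ M := by exact_mod_cast hM
  have hlog : 0 < Real.log M := Real.log_pos (by linarith)
  set B := ((Finset.Ioc (4 ^ j) (4 ^ (j + 1))).filter Nat.Prime).filter
      (fun p => logBin M j p = b) with hB
  rcases B.eq_empty_or_nonempty with hempty | hne
  · rw [hempty]
    simp
    positivity
  have hmem : ∀ p ∈ B, (4 ^ j < p ∧ p ≤ 4 ^ (j + 1)) ∧ p.Prime ∧ logBin M j p = b := by
    intro p hp
    simpa [hB, and_assoc] using hp
  obtain ⟨⟨hp1, hp2⟩, -, hp4⟩ := hmem _ (B.min'_mem hne)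
  set p := B.min' hne
  set h := ⌊(12 * 4 ^ j / M : ℝ)⌋₊ + 1
  have hMj : M ≤ 4 ^ j := (Nat.le_self_pow (by norm_num) M).trans hj
  have hsub : B ⊆ (Finset.Ioc (p - 1) (p - 1 + h)).filter Nat.Prime := by
    intro q hq
    obtain ⟨⟨hq1, hq2⟩, hq3, hq4⟩ := hmem q hq
    have hpq : p ≤ q := B.min'_le q hq
    have h1 := le_add_of_logBin_eq (M := M) (by omega) hp1 hq1 hp2 (hp4.trans hq4.symm)
    have h2 : ((q - p : ℕ) : ℝ) ≤ 12 * 4 ^ j / M := by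
      rw [Nat.cast_sub hpq]; linarith
    have h3 : q - p ≤ ⌊(12 * 4 ^ j / M : ℝ)⌋₊ := Nat.le_floor h2
    simp only [Finset.mem_filter, Finset.mem_Ioc]
    refine ⟨?_, hq3⟩
    omega
  have hsieve := card_primes_Ioc_le (p - 1) h M (by omega) (by omega)
  have hS : Real.log M / 2 ≤ squarefreeSum M := by
    have := log_le_two_mul_squarefreeSum M
    have h2 : Real.log M ≤ Real.log (M + 1) := Real.log_le_log (by linarith) (by linarith)
    linarith
  have hX : (M : ℝ) ^ 7 ≤ 4 ^ j := by exact_mod_cast hj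
  have hh : (h : ℝ) ≤ 14 * 4 ^ j / M - 4 ^ j / M := by
    have h1 : (⌊(12 * 4 ^ j / M : ℝ)⌋₊ : ℝ) ≤ 12 * 4 ^ j / M := Nat.floor_le (by positivity)
    have h2 : (1 : ℝ) ≤ 4 ^ j / M := by
      rw [one_le_div (by linarith)]; exact_mod_cast hMj
    have h3 : (h : ℝ) = (⌊(12 * 4 ^ j / M : ℝ)⌋₊ : ℝ) + 1 := by simp [h]
    rw [h3]
    have e : (14 : ℝ) * 4 ^ j / M - 4 ^ j / M = 12 * 4 ^ j / M + 4 ^ j / M := by ring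
    linarith
  have hlogM : Real.log M ≤ M := (Real.log_le_sub_one_of_pos (by linarith)).trans (by linarith)
  have h4 : (M : ℝ) ^ 4 ≤ 4 ^ j / (M * Real.log M) := by
    rw [le_div_iff₀ (by positivity)]
    calc (M : ℝ) ^ 4 * (M * Real.log M) ≤ (M : ℝ) ^ 4 * (M * M) := by gcongr
      _ = (M : ℝ) ^ 6 := by ring
      _ ≤ (M : ℝ) ^ 7 := pow_le_pow_right₀ (by linarith) (by norm_num)
      _ ≤ _ := hX
  calc (B.card : ℝ) ≤ (((Finset.Ioc (p - 1) (p - 1 + h)).filter Nat.Prime).card : ℝ) := by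
        exact_mod_cast Finset.card_le_card hsub
    _ ≤ h / squarefreeSum M + (M : ℝ) ^ 4 := hsieve
    _ ≤ (14 * 4 ^ j / M) / (Real.log M / 2) + 4 ^ j / (M * Real.log M) := by
        gcongr
        have : (0 : ℝ) ≤ 4 ^ j / M := by positivity
        linarith
    _ = 29 * 4 ^ j / (M * Real.log M) := by field_simp; norm_num

-- Cauchy–Davenport, iterated: each summand adds at least `A.card - 1` residues until all are
-- reached.
open Pointwise in
theorem min_le_card_nsmul {M : ℕ} [Fact M.Prime] {A : Finset (ZMod M)} (hA : A.Nonempty) (r : ℕ) :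
    min M (r * (A.card - 1) + 1) ≤ (r • A).card := by
  induction r with
  | zero => simp
  | succ r ih =>
    rw [succ_nsmul]
    have h := ZMod.cauchy_davenport Fact.out (hA.nsmul (n := r)) hA
    have hc := hA.card_pos
    have e : (r + 1) * (A.card - 1) = r * (A.card - 1) + (A.card - 1) := by ring
    omega

/-- The logarithms of the primes are well distributed modulo `log 4`. -/
theorem eventually_card_image_logBin :
    ∀ᶠ M : ℕ in Filter.atTop, (M : ℝ) ^ 7 ≤ 4 ^ ⌊7 * Real.log M⌋₊ ∧
      (M : ℝ) ≤ 464 * ((((Finset.Ioc (4 ^ ⌊7 * Real.log M⌋₊) (4 ^ (⌊7 * Real.log M⌋₊ + 1))).filter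
        Nat.Prime).image (logBin M ⌊7 * Real.log M⌋₊)).card : ℝ) := by
  have hlogtop : Filter.Tendsto (fun M : ℕ => Real.log M) Filter.atTop Filter.atTop :=
    Real.tendsto_log_atTop.comp tendsto_natCast_atTop_atTop
  have hj : Filter.Tendsto (fun M : ℕ => ⌊7 * Real.log M⌋₊) Filter.atTop Filter.atTop :=
    tendsto_nat_floor_atTop.comp (hlogtop.const_mul_atTop (by norm_num))
  filter_upwards [hj.eventually eventually_four_pow_le_card_primes,
    hlogtop.eventually_ge_atTop 1, Filter.eventually_ge_atTop 2] with M hN hlog hM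
  set j := ⌊7 * Real.log M⌋₊
  have hj1 : (j : ℝ) ≤ 7 * Real.log M := Nat.floor_le (by positivity)
  have hj2 : 7 * Real.log M < j + 1 := Nat.lt_floor_add_one _
  have hM0 : (2 : ℝ) ≤ M := by exact_mod_cast hM
  have hX : (M : ℝ) ^ 7 ≤ 4 ^ j := by
    rw [← Real.log_le_log_iff (by positivity) (by positivity), Real.log_pow, Real.log_pow,
      show (4 : ℝ) = 2 ^ 2 by norm_num, Real.log_pow]
    have := Real.log_two_gt_d9
    push_cast
    nlinarith
  refine ⟨hX, ?_⟩
  set P := (Finset.Ioc (4 ^ j) (4 ^ (j + 1))).filter Nat.Prime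
  have hcard : (P.card : ℝ) ≤ ((P.image (logBin M j)).card : ℝ) * (29 * 4 ^ j / (M * Real.log M)) := by
    rw [Finset.card_eq_sum_card_image (logBin M j) P]
    push_cast
    rw [← nsmul_eq_mul]
    exact Finset.sum_le_card_nsmul _ _ _ fun b _ =>
      card_filter_logBin_le hM (by exact_mod_cast hX) b
  set a : ℝ := ((P.image (logBin M j)).card : ℝ)
  have ha : 0 ≤ a := Nat.cast_nonneg _
  have h4 : (0 : ℝ) < 4 ^ j := by positivity
  -- Here `j + 1 ≤ 8 log M`, and `464 = 2 * 8 * 29`.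
  have h1 : (4 : ℝ) ^ j ≤ 2 * (8 * Real.log M) * (a * (29 * 4 ^ j / (M * Real.log M))) := by
    refine hN.trans ?_
    gcongr
    linarith
  have h2 : 2 * (8 * Real.log M) * (a * (29 * 4 ^ j / (M * Real.log M))) = 4 ^ j * (464 * a / M) := by
    field_simp
    ring
  rw [h2] at h1
  have h3 : 1 ≤ 464 * a / M := by
    by_contra hcon
    push Not at hcon
    nlinarith
  rwa [one_le_div (by linarith)] at h3

open Pointwise in
/-- A product of `500` large primes slightly below a power of `4`. -/
theorem eventually_exists_primes_prod :
    ∀ᶠ M : ℕ in Filter.atTop, M.Prime → ∃ (p : Fin 500 → ℕ) (s : ℕ),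
      (∀ i, (p i).Prime ∧ M ≤ p i) ∧ (s : ℝ) ≤ 4500 * Real.log M ∧
      (s - 501 / M) * Real.log 4 ≤ Real.log (∏ i, p i : ℕ) ∧
      Real.log (∏ i, p i : ℕ) ≤ (s - 1 / M) * Real.log 4 := by
  have hlogtop : Filter.Tendsto (fun M : ℕ => Real.log M) Filter.atTop Filter.atTop :=
    Real.tendsto_log_atTop.comp tendsto_natCast_atTop_atTop
  filter_upwards [eventually_card_image_logBin, hlogtop.eventually_ge_atTop 10,
    Filter.eventually_ge_atTop 20000] with M hMbin hlog hM hprime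
  have : Fact M.Prime := ⟨hprime⟩
  set j := ⌊7 * Real.log M⌋₊
  obtain ⟨hX, hA⟩ := hMbin
  have hM0 : (20000 : ℝ) ≤ M := by exact_mod_cast hM
  set P := (Finset.Ioc (4 ^ j) (4 ^ (j + 1))).filter Nat.Prime with hP
  set I := P.image (logBin M j) with hI
  let A : Finset (ZMod M) := I.image fun b : ℕ => (b : ZMod M)
  -- The bin values lie in `{0, …, M}`; modulo `M` only the two extreme ones can collide.
  have hIA : I.card ≤ A.card + 1 := by
    have hsub : I ⊆ insert M (I.filter (· < M)) := by
      intro b hb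
      obtain ⟨p, hp, rfl⟩ := Finset.mem_image.1 hb
      rw [hP, Finset.mem_filter, Finset.mem_Ioc] at hp
      have := logBin_le (M := M) hp.1.1 hp.1.2
      rcases this.eq_or_lt with h | h
      · exact Finset.mem_insert.2 (.inl h)
      · exact Finset.mem_insert_of_mem (Finset.mem_filter.2 ⟨hb, h⟩)
    refine (Finset.card_le_card hsub).trans ((Finset.card_insert_le _ _).trans ?_)
    gcongr
    refine Finset.card_le_card_of_injOn (fun b : ℕ => (b : ZMod M)) ?_ ?_
    · intro b hb
      exact Finset.mem_coe.2 (Finset.mem_image_of_mem _ (Finset.mem_filter.1 hb).1)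
    · intro b hb c hc hbc
      have hb' := (Finset.mem_filter.1 hb).2
      have hc' := (Finset.mem_filter.1 hc).2
      have := (ZMod.natCast_eq_natCast_iff' b c M).1 hbc
      rwa [Nat.mod_eq_of_lt hb', Nat.mod_eq_of_lt hc'] at this
  have hAc : (M : ℝ) ≤ 464 * ((A.card : ℝ) + 1) := by
    refine hA.trans ?_
    gcongr
    exact_mod_cast hIA
  have hAc' : M ≤ 464 * (A.card + 1) := by exact_mod_cast hAc
  have hAne : A.Nonempty := by
    rw [← Finset.card_pos]
    omega
  -- `A` contains about `M / 464` residues or more, so 500 summands suffice; the surplus absorbs the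
  -- additive losses once `M ≥ 20000`.
  have hfull : (500 • A : Finset (ZMod M)) = Finset.univ := by
    rw [← Finset.card_eq_iff_eq_univ, ZMod.card]
    refine le_antisymm ((Finset.card_le_univ _).trans_eq (ZMod.card M)) ?_
    refine le_trans ?_ (min_le_card_nsmul hAne 500)
    have hc := hAne.card_pos
    rw [le_min_iff]
    omega
  -- Rounding down 500 positions loses between `0` and `500` in total. Bins summing to `-501` modulo
  -- `M` thus place the true sum between `501` and `1` below a multiple of `M`.
  obtain ⟨f, hf⟩ := Finset.mem_nsmul.1 (hfull ▸ Finset.mem_univ (-501 : ZMod M))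
  rw [List.sum_ofFn] at hf
  have hchoose : ∀ i, ∃ q ∈ P, ((logBin M j q : ℕ) : ZMod M) = f i := by
    intro i
    obtain ⟨b, hb, hbf⟩ := Finset.mem_image.1 (f i).2
    obtain ⟨q, hq, rfl⟩ := Finset.mem_image.1 hb
    exact ⟨q, hq, hbf⟩
  choose p hpP hpf using hchoose
  have hp : ∀ i, (4 ^ j < p i ∧ p i ≤ 4 ^ (j + 1)) ∧ (p i).Prime := fun i => by
    simpa [hP] using hpP i
  have hdvd : M ∣ ∑ i, logBin M j (p i) + 501 := by
    rw [← ZMod.natCast_eq_zero_iff]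
    push_cast
    rw [Finset.sum_congr rfl fun i _ => hpf i, hf]
    simp
  obtain ⟨w, hw⟩ := hdvd
  have hw' : ∑ i, (logBin M j (p i) : ℝ) + 501 = M * w := by exact_mod_cast hw
  have hMj : M ≤ 4 ^ j := by
    have h7 : M ^ 7 ≤ 4 ^ j := by exact_mod_cast hX
    exact (Nat.le_self_pow (by norm_num) M).trans h7
  have hMpos : (0 : ℝ) < M := by linarith
  have hlogprod : Real.log (∏ i, p i : ℕ) = ∑ i, Real.log (p i) := by
    push_cast
    rw [Real.log_prod]
    intro i _
    exact_mod_cast (hp i).2.ne_zero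
  have hsum : ∑ i, (M : ℝ) * (Real.log (p i) / Real.log 4 - j)
      = M * (Real.log (∏ i, p i : ℕ) / Real.log 4 - 500 * j) := by
    rw [← Finset.mul_sum, Finset.sum_sub_distrib, ← Finset.sum_div, hlogprod]
    simp
  have hlo : ∑ i, (logBin M j (p i) : ℝ) ≤ ∑ i, (M : ℝ) * (Real.log (p i) / Real.log 4 - j) :=
    Finset.sum_le_sum fun i _ => (logBin_bounds (hp i).1.1).1
  have hhi : ∑ i, (M : ℝ) * (Real.log (p i) / Real.log 4 - j)
      ≤ ∑ i, (logBin M j (p i) : ℝ) + 500 := by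
    refine (Finset.sum_le_sum fun i _ => (logBin_bounds (hp i).1.1).2.le).trans ?_
    rw [Finset.sum_add_distrib]
    simp
  rw [hsum] at hlo hhi
  generalize hL : Real.log (∏ i, p i : ℕ) = L at hlo hhi
  have hwle : (w : ℝ) ≤ 501 := by
    have hb : ∑ i, (logBin M j (p i) : ℝ) ≤ ∑ _i : Fin 500, (M : ℝ) :=
      Finset.sum_le_sum fun i _ => by exact_mod_cast logBin_le (hp i).1.1 (hp i).1.2
    simp only [Finset.sum_const, Finset.card_univ, Fintype.card_fin, nsmul_eq_mul] at hb
    push_cast at hb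
    by_contra hcon
    push Not at hcon
    have : (M : ℝ) * 501 < M * w := mul_lt_mul_of_pos_left hcon hMpos
    linarith
  have hj1 : (j : ℝ) ≤ 7 * Real.log M := Nat.floor_le (by positivity)
  have hs : ((500 * j + w : ℕ) : ℝ) = 500 * j + w := by push_cast; rfl
  refine ⟨p, 500 * j + w, fun i => ⟨(hp i).2, by have := (hp i).1.1; omega⟩, ?_, ?_, ?_⟩
  · rw [hs]
    linarith
  · rw [hs, hL, ← le_div_iff₀ log_four_pos]
    have : (M : ℝ) * (500 * j + w - 501 / M) ≤ M * (L / Real.log 4) := by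
      rw [mul_sub, mul_div_cancel₀ _ hMpos.ne']
      linarith
    exact (mul_le_mul_iff_right₀ hMpos).1 this
  · rw [hs, hL, ← div_le_iff₀ log_four_pos]
    have : M * (L / Real.log 4) ≤ (M : ℝ) * (500 * j + w - 1 / M) := by
      rw [mul_sub, mul_div_cancel₀ _ hMpos.ne']
      linarith
    exact (mul_le_mul_iff_right₀ hMpos).1 this

/-! ### Labellings from products of prime fields. -/

theorem card_units_pi_zmod {r : ℕ} (p : Fin r → ℕ) (hp : ∀ i, (p i).Prime)
    [∀ i, NeZero (p i)] [Fintype (∀ i, ZMod (p i))ˣ] :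
    Fintype.card (∀ i, ZMod (p i))ˣ = ∏ i, (p i - 1) := by
  classical
  rw [Fintype.card_congr (MulEquiv.piUnits (M := fun i => ZMod (p i))).toEquiv, Fintype.card_pi]
  exact Finset.prod_congr rfl fun i _ => by
    rw [ZMod.card_units_eq_totient, Nat.totient_prime (hp i)]

/-- Labellings from the ring `∏ i, ZMod (p i)`. -/
theorem exists_hasLabelling_primes {r M s : ℕ} (hr : 0 < r) (hM : 1 ≤ M) (p : Fin r → ℕ)
    (hp : ∀ i, (p i).Prime ∧ M ≤ p i) (hs : ∏ i, p i ≤ 4 ^ s) :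
    M ≤ ∏ i, p i ∧ ∃ u : ℕ, ((∏ i, p i : ℕ) : ℝ) * (1 - r / M) ≤ u ∧ u ≤ ∏ i, p i ∧
      ∀ k a : ℕ, ∃ m : ℕ, m * u ≤ (∏ i, p i) ^ k + (∏ i, p i) * (∏ i, p i - u) ^ k ∧
        HasLabelling (2 ^ a * (m * (2 ^ (2 * s) - 1) + 1) - 1) (2 ^ a * (∏ i, p i) ^ k) := by
  have hM0 : (1 : ℝ) ≤ M := by exact_mod_cast hM
  have hMpos : (0 : ℝ) < M := by linarith
  have hQpos : 0 < ∏ i, p i := Finset.prod_pos fun i _ => (hp i).1.pos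
  have : ∀ i, NeZero (p i) := fun i => ⟨(hp i).1.ne_zero⟩
  classical
  have hcardR : Fintype.card (∀ i, ZMod (p i)) = ∏ i, p i := by
    rw [Fintype.card_pi]
    exact Finset.prod_congr rfl fun i _ => ZMod.card _
  have hcardU := card_units_pi_zmod p fun i => (hp i).1
  have hMQ : M ≤ ∏ i, p i := (hp ⟨0, hr⟩).2.trans
    (Nat.le_of_dvd hQpos (Finset.dvd_prod_of_mem p (Finset.mem_univ _)))
  refine ⟨hMQ, ∏ i, (p i - 1), ?_,
    Finset.prod_le_prod' fun i _ => Nat.sub_le _ _, fun k a => ?_⟩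
  · have h1 : ∏ i, ((p i : ℝ) * (1 - 1 / M)) ≤ ∏ i, ((p i - 1 : ℕ) : ℝ) := by
      refine Finset.prod_le_prod (fun i _ => ?_) fun i _ => ?_
      · refine mul_nonneg (Nat.cast_nonneg _) (sub_nonneg.2 ?_)
        rw [div_le_one hMpos]; linarith
      · have hpi : (M : ℝ) ≤ p i := by exact_mod_cast (hp i).2
        rw [Nat.cast_sub (hp i).1.one_le, mul_sub, mul_one, mul_one_div, Nat.cast_one]
        have : 1 ≤ (p i : ℝ) / M := by rwa [one_le_div hMpos]
        linarith
    rw [Finset.prod_mul_distrib, Finset.prod_const, Finset.card_univ, Fintype.card_fin] at h1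
    have h2 : 1 + (r : ℝ) * (-(1 / M : ℝ)) ≤ (1 + -(1 / M : ℝ)) ^ r := by
      refine one_add_mul_le_pow ?_ r
      have : (1 / M : ℝ) ≤ 1 := by rw [div_le_one hMpos]; linarith
      linarith
    have h3 : (1 : ℝ) - r / M ≤ (1 - 1 / M) ^ r := by
      rw [← sub_eq_add_neg] at h2
      refine le_trans (le_of_eq ?_) h2
      ring
    refine le_trans ?_ (h1.trans_eq (Nat.cast_prod _ _).symm)
    rw [Nat.cast_prod]
    gcongr
  · obtain ⟨m, hm, hlab⟩ := exists_hasLabelling_ring (∀ i, ZMod (p i)) (2 * s) k a (by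
      rwa [hcardR, pow_mul])
    rw [hcardR, hcardU] at hm
    rw [hcardR] at hlab
    exact ⟨m, hm, hlab⟩

/-- The loss `n' + 1` against `N` collects three defects of size `O(1 / M)`: `Q` against `4 ^ s`,
the units `u` against `Q`, and the vectors without unit entries, negligible because `k ≥ M`. -/
theorem exists_le_alphabet {M s Q u : ℕ} (hM : 1000000 ≤ M) (hQpos : 0 < Q)
    (hs : (s : ℝ) ≤ 4500 * Real.log M) (hlo : (s - 501 / M) * Real.log 4 ≤ Real.log Q)
    (hhi : Real.log Q ≤ (s - 1 / M) * Real.log 4) (hMQ : M ≤ Q)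
    (hu1 : (Q : ℝ) * (1 - 500 / M) ≤ u) (huQ : u ≤ Q)
    (hex : ∀ k a : ℕ, ∃ m : ℕ, m * u ≤ Q ^ k + Q * (Q - u) ^ k ∧
        HasLabelling (2 ^ a * (m * (2 ^ (2 * s) - 1) + 1) - 1) (2 ^ a * Q ^ k))
    (k a : ℕ) (hk : M ≤ k) :
    ∃ n' : ℕ, (n' : ℝ) + 1 ≤ (1 + 3000 / M) * (2 ^ a * Q ^ k) ∧
      HasLabelling n' (2 ^ a * Q ^ k) := by
  have hM0 : (1000000 : ℝ) ≤ M := by exact_mod_cast hM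
  have hMpos : (0 : ℝ) < M := by linarith
  have hQ0 : (0 : ℝ) < Q := by exact_mod_cast hQpos
  have hlog2 := Real.log_two_lt_d9
  have hlog2' := Real.log_two_gt_d9
  have hlog4 : Real.log 4 = 2 * Real.log 2 := by
    rw [show (4 : ℝ) = 2 ^ 2 by norm_num, Real.log_pow]; norm_num
  have hlogM : 0 < Real.log M := Real.log_pos (by linarith)
  have hd0 : (0 : ℝ) < 1 / M := by positivity
  have hQs : (Q : ℝ) ≤ 4 ^ s := by
    rw [← Real.log_le_log_iff hQ0 (by positivity), Real.log_pow]
    exact hhi.trans (mul_le_mul_of_nonneg_right (by linarith) log_four_pos.le)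
  -- The constant comes from `501 log 4 < 700`.
  have hQs' : (4 : ℝ) ^ s * (1 - 700 / M) ≤ Q := by
    have h1 : (1 : ℝ) - 700 / M ≤ Real.exp (-(501 / M * Real.log 4)) := by
      have h2 := Real.add_one_le_exp (-(501 / M * Real.log 4))
      have h3 : (501 : ℝ) / M * Real.log 4 ≤ 700 / M := by
        rw [div_mul_eq_mul_div]
        gcongr
        linarith
      linarith
    calc (4 : ℝ) ^ s * (1 - 700 / M)
        ≤ Real.exp (s * Real.log 4) * Real.exp (-(501 / M * Real.log 4)) := by
          rw [← Real.log_pow, Real.exp_log (by positivity)]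
          gcongr
      _ = Real.exp ((s - 501 / M) * Real.log 4) := by rw [← Real.exp_add]; congr 1; ring
      _ ≤ Real.exp (Real.log Q) := Real.exp_le_exp.2 hlo
      _ = Q := Real.exp_log hQ0
  -- `Q ≤ M ^ 6300` because `4500 log 4 < 6300`, while `500 / M ≤ M ^ (-1/2)`; the exponent `k ≥ M ≥
  -- 10 ^ 6` wins.
  have hsmall : (Q : ℝ) * (500 / M) ^ k ≤ 1 / M := by
    have h1 : (500 : ℝ) / M ≤ Real.exp (-(Real.log M / 2)) := by
      rw [← Real.log_le_iff_le_exp (by positivity), Real.log_div (by norm_num) hMpos.ne']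
      have h2 : 2 * Real.log 500 ≤ Real.log M := by
        have : Real.log (500 ^ 2) ≤ Real.log M := Real.log_le_log (by norm_num) (by linarith)
        rw [Real.log_pow] at this
        exact_mod_cast this
      linarith
    have hk' : (M : ℝ) ≤ k := by exact_mod_cast hk
    calc (Q : ℝ) * (500 / M) ^ k
        ≤ Real.exp (6300 * Real.log M) * Real.exp (-(Real.log M / 2)) ^ k := by
          gcongr
          rw [← Real.log_le_iff_le_exp hQ0]
          refine hhi.trans ?_
          have h3 : (s - 1 / M) * Real.log 4 ≤ s * Real.log 4 := by
            exact mul_le_mul_of_nonneg_right (by linarith) log_four_pos.le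
          rw [hlog4] at h3 ⊢
          nlinarith
      _ = Real.exp (6300 * Real.log M - k * (Real.log M / 2)) := by
          rw [← Real.exp_nat_mul, ← Real.exp_add]; congr 1; ring
      _ ≤ Real.exp (-Real.log M) := by
          rw [Real.exp_le_exp]
          nlinarith
      _ = 1 / M := by rw [Real.exp_neg, Real.exp_log hMpos, one_div]
  obtain ⟨m, hm, hlab⟩ := hex k a
  refine ⟨_, ?_, hlab⟩
  have hpos : 0 < 2 ^ a * (m * (2 ^ (2 * s) - 1) + 1) := by positivity
  have hn : ((2 ^ a * (m * (2 ^ (2 * s) - 1) + 1) - 1 : ℕ) : ℝ) + 1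
      ≤ 2 ^ a * (m * 4 ^ s + 1) := by
    have h1 : 2 ^ a * (m * (2 ^ (2 * s) - 1) + 1) - 1 + 1 ≤ 2 ^ a * (m * 4 ^ s + 1) := by
      rw [Nat.sub_add_cancel hpos, pow_mul]
      gcongr
      exact Nat.sub_le _ _
    exact_mod_cast h1
  refine hn.trans ?_
  have hd : (1 / M : ℝ) ≤ 1 / 1000000 := by gcongr
  have e1 : (500 : ℝ) / M = 500 * (1 / M) := by ring
  have e2 : (700 : ℝ) / M = 700 * (1 / M) := by ring
  have e3 : (3000 : ℝ) / M = 3000 * (1 / M) := by ring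
  have hQk : (M : ℝ) ≤ Q ^ k := by
    have h1 : M ≤ Q ^ k := hMQ.trans (Nat.le_self_pow (by omega) Q)
    exact_mod_cast h1
  -- This absorbs the `+ 1` in `m * 4 ^ s + 1`.
  have hone : 1 ≤ (Q : ℝ) ^ k * (1 / M) := by
    rw [mul_one_div, one_le_div hMpos]; exact hQk
  have hmu : (m : ℝ) * u ≤ Q ^ k * (1 + 1 / M) := by
    have h1 : (m : ℝ) * u ≤ Q ^ k + Q * (Q - u : ℕ) ^ k := by exact_mod_cast hm
    have h2 : ((Q - u : ℕ) : ℝ) ≤ Q * (500 / M) := by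
      rw [Nat.cast_sub huQ]; linarith
    calc (m : ℝ) * u ≤ Q ^ k + Q * (Q * (500 / M)) ^ k := by
          refine h1.trans ?_
          gcongr
      _ = Q ^ k * (1 + Q * (500 / M) ^ k) := by rw [mul_pow]; ring
      _ ≤ _ := by gcongr
  rw [e1] at hu1
  rw [e2] at hQs'
  rw [e3]
  generalize (1 / M : ℝ) = d at *
  have hu2 : (4 : ℝ) ^ s * (1 - 1200 * d) ≤ u := by
    have h1 : (4 : ℝ) ^ s * (1 - 700 * d) * (1 - 500 * d) ≤ u :=
      (mul_le_mul_of_nonneg_right hQs' (by linarith)).trans hu1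
    have h2 : (1 - 1200 * d) ≤ (1 - 700 * d) * (1 - 500 * d) := by nlinarith
    calc (4 : ℝ) ^ s * (1 - 1200 * d) ≤ 4 ^ s * ((1 - 700 * d) * (1 - 500 * d)) := by gcongr
      _ ≤ u := by rwa [← mul_assoc]
  have hm4 : (m : ℝ) * 4 ^ s ≤ Q ^ k * (1 + 2000 * d) := by
    have h1 : (m : ℝ) * 4 ^ s * (1 - 1200 * d) ≤ Q ^ k * (1 + 2000 * d) * (1 - 1200 * d) := by
      calc (m : ℝ) * 4 ^ s * (1 - 1200 * d) = m * (4 ^ s * (1 - 1200 * d)) := by ring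
        _ ≤ m * u := by gcongr
        _ ≤ Q ^ k * (1 + d) := hmu
        _ ≤ Q ^ k * ((1 + 2000 * d) * (1 - 1200 * d)) := by
          gcongr
          nlinarith
        _ = _ := by ring
    exact le_of_mul_le_mul_right h1 (by linarith)
  calc (2 : ℝ) ^ a * (m * 4 ^ s + 1) ≤ 2 ^ a * (Q ^ k * (1 + 2000 * d) + Q ^ k * d) := by gcongr
    _ = (1 + 2001 * d) * (2 ^ a * Q ^ k) := by ring
    _ ≤ (1 + 3000 * d) * (2 ^ a * Q ^ k) := by gcongr; norm_num

theorem eventually_exists_alphabet :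
    ∀ᶠ M : ℕ in Filter.atTop, M.Prime → ∃ Q s : ℕ, 0 < Q ∧ (s : ℝ) ≤ 4500 * Real.log M ∧
      (s - 501 / M) * Real.log 4 ≤ Real.log Q ∧ Real.log Q ≤ (s - 1 / M) * Real.log 4 ∧
      ∀ k a : ℕ, M ≤ k → ∃ n' : ℕ, (n' : ℝ) + 1 ≤ (1 + 3000 / M) * (2 ^ a * Q ^ k) ∧
        HasLabelling n' (2 ^ a * Q ^ k) := by
  filter_upwards [eventually_exists_primes_prod, Filter.eventually_ge_atTop 1000000] with M hex hM hprime
  obtain ⟨p, s, hp, hs, hlo, hhi⟩ := hex hprime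
  have hMpos : (0 : ℝ) < M := by
    have : 0 < M := by omega
    exact_mod_cast this
  have hQpos : 0 < ∏ i, p i := Finset.prod_pos fun i _ => (hp i).1.pos
  have hQs : ∏ i, p i ≤ 4 ^ s := by
    have h1 : ((∏ i, p i : ℕ) : ℝ) ≤ (4 ^ s : ℕ) := by
      rw [← Real.log_le_log_iff (by exact_mod_cast hQpos) (by positivity)]
      refine hhi.trans ?_
      rw [Nat.cast_pow, Real.log_pow]
      have hd0 : (0 : ℝ) < 1 / M := by positivity
      exact mul_le_mul_of_nonneg_right (by linarith) log_four_pos.le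
    exact_mod_cast h1
  obtain ⟨hMQ, u, hu1, huQ, hlab⟩ :=
    exists_hasLabelling_primes (by norm_num) (by omega) p hp hQs
  exact ⟨∏ i, p i, s, hQpos, hs, hlo, hhi, exists_le_alphabet hM hQpos hs hlo hhi hMQ
    (by exact_mod_cast hu1) huQ hlab⟩

/-! ### Fitting the labellings to every large length. -/

/-- Approximation of `y` from below by `a * l + k * (c * l - ε)`. -/
theorem exists_nat_combination {y l ε : ℝ} {c M : ℕ} (hl : 0 < l) (hε : 0 < ε)
    (hM : l ≤ ε * (M - 1)) (hy : 2 * c * M * l ≤ y) :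
    ∃ k a : ℕ, M ≤ k ∧ a * l + k * (c * l - ε) ≤ y ∧ y ≤ a * l + k * (c * l - ε) + ε := by
  -- `T * l` exceeds `y + M * ε` by less than `l`. Descending from it by `k = M + i` steps of `ε`
  -- lands within `ε` below `y`, and `l ≤ ε * (M - 1)` keeps `i ≤ M`. Then `a = T - c * k`, which is
  -- nonnegative by `hy` since `k ≤ 2 * M`.
  set T := ⌈(y + M * ε) / l⌉ with hT
  have hT1 : y + M * ε ≤ T * l := by
    rw [← div_le_iff₀ hl]; exact Int.le_ceil _
  have hT2 : T * l < y + M * ε + l := by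
    have h1 : (T : ℝ) < (y + M * ε) / l + 1 := Int.ceil_lt_add_one _
    have h2 : (T : ℝ) * l < ((y + M * ε) / l + 1) * l := by gcongr
    rwa [add_mul, one_mul, div_mul_cancel₀ _ hl.ne'] at h2
  set i := ⌈(T * l - y - M * ε) / ε⌉₊
  have hi1 : T * l - y - M * ε ≤ i * ε := by
    rw [← div_le_iff₀ hε]; exact Nat.le_ceil _
  have hi2 : i * ε < T * l - y - M * ε + ε := by
    have h1 : (i : ℝ) < (T * l - y - M * ε) / ε + 1 :=
      Nat.ceil_lt_add_one (div_nonneg (by linarith) hε.le)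
    have h2 : (i : ℝ) * ε < ((T * l - y - M * ε) / ε + 1) * ε := by gcongr
    rwa [add_mul, one_mul, div_mul_cancel₀ _ hε.ne'] at h2
  have hiM : (i : ℝ) ≤ M := by
    have h3 : (i : ℝ) * ε < M * ε := by nlinarith
    exact (lt_of_mul_lt_mul_right h3 hε.le).le
  have hiM' : i ≤ M := by exact_mod_cast hiM
  have hTc : ((c * (M + i) : ℕ) : ℤ) ≤ T := by
    have h1 : ((c * (M + i) : ℕ) : ℝ) ≤ 2 * c * M := by
      have : c * (M + i) ≤ c * (M + M) := by gcongr
      calc ((c * (M + i) : ℕ) : ℝ) ≤ ((c * (M + M) : ℕ) : ℝ) := by exact_mod_cast this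
        _ = 2 * c * M := by push_cast; ring
    have h2 : ((c * (M + i) : ℕ) : ℝ) * l ≤ T * l := by
      have : (0 : ℝ) ≤ M * ε := by positivity
      calc ((c * (M + i) : ℕ) : ℝ) * l ≤ 2 * c * M * l := by gcongr
        _ ≤ T * l := by linarith
    have h3 := le_of_mul_le_mul_right h2 hl
    exact_mod_cast h3
  obtain ⟨a, ha⟩ := Int.eq_ofNat_of_zero_le (sub_nonneg.2 hTc)
  have ha' : (T : ℝ) = a + c * (M + i) := by
    have : (T : ℤ) = a + (c * (M + i) : ℕ) := by linarith
    rw [this]; push_cast; ring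
  rw [ha'] at hi1 hi2
  refine ⟨M + i, a, Nat.le_add_right _ _, ?_, ?_⟩ <;> push_cast <;> nlinarith

theorem mul_mul_le_of_le {d N E : ℝ} (hd0 : 0 ≤ d) (hd : d ≤ 1 / 10000) (hN : 0 ≤ N)
    (hE : E ≤ 1 + 1400 * d) : (1 + 3000 * d) * N * E ≤ (1 + 5000 * d) * N := by
  calc (1 + 3000 * d) * N * E ≤ (1 + 3000 * d) * N * (1 + 1400 * d) := by gcongr
    _ = ((1 + 3000 * d) * (1 + 1400 * d)) * N := by ring
    _ ≤ (1 + 5000 * d) * N := by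
      gcongr
      nlinarith

/-- The best `2 ^ a * Q ^ k` below the target is within a factor `exp ε` of it, and the unused
coordinates up to `n` are ignored by the labelling. -/
theorem eventually_hasLabelling :
    ∀ᶠ M : ℕ in Filter.atTop, M.Prime → ∀ n : ℕ, 13000 * M * Real.log M ≤ Real.log n →
      ∃ N : ℕ, HasLabelling n N ∧ (n : ℝ) + 1 ≤ (1 + 5000 / M) * N := by
  filter_upwards [eventually_exists_alphabet, Filter.eventually_ge_atTop 10000000] with M hex hM hprime n hn
  obtain ⟨Q, s, hQ, hs, hlo, hhi, hlab⟩ := hex hprime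
  have hM0 : (10000000 : ℝ) ≤ M := by exact_mod_cast hM
  have hMpos : (0 : ℝ) < M := by linarith
  have hlog2 := Real.log_two_lt_d9
  have hlog2' := Real.log_two_gt_d9
  have hlog4 : Real.log 4 = 2 * Real.log 2 := by
    rw [show (4 : ℝ) = 2 ^ 2 by norm_num, Real.log_pow]; norm_num
  have hlogM : 1 ≤ Real.log M := by
    rw [Real.le_log_iff_exp_le hMpos]
    have := Real.exp_one_lt_d9
    linarith
  have hd : (1 / M : ℝ) ≤ 1 / 10000000 := by gcongr
  have hd0 : (0 : ℝ) < 1 / M := by positivity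
  have hQ0 : (0 : ℝ) < Q := by exact_mod_cast hQ
  have hn0 : (0 : ℝ) < n := by
    rcases Nat.eq_zero_or_pos n with rfl | h
    · simp at hn
      nlinarith
    · exact_mod_cast h
  set ε : ℝ := (2 * s : ℕ) * Real.log 2 - Real.log Q with hε
  have hQe : Real.log Q = (2 * s : ℕ) * Real.log 2 - ε := by rw [hε]; ring
  have hε1 : 1 / M * (2 * Real.log 2) ≤ ε := by
    rw [hε]; push_cast; rw [hlog4] at hhi; linarith
  have hε2 : ε ≤ 700 * (1 / M) := by
    rw [hε]; push_cast; rw [hlog4] at hlo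
    have e : (501 : ℝ) / M = 501 * (1 / M) := by ring
    rw [e] at hlo
    nlinarith
  have hε0 : 0 < ε := lt_of_lt_of_le (by positivity) hε1
  have hlogn1 : Real.log n ≤ Real.log (n + 1) := Real.log_le_log hn0 (by linarith)
  have hfac : Real.log (1 + 3000 / M) ≤ 1 := by
    refine (Real.log_le_sub_one_of_pos (by positivity)).trans ?_
    have e : (3000 : ℝ) / M = 3000 * (1 / M) := by ring
    rw [e]; linarith
  -- Subtracting `log (1 + 3000 / M)` leaves room for `n' ≤ n`. The threshold on `y` is at most
  -- `18000 log 2 < 12500` times `M log M`, whence the `13000` in the hypothesis.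
  obtain ⟨k, a, hk, h1, h2⟩ := exists_nat_combination (y := Real.log (n + 1) - Real.log (1 + 3000 / M))
    (l := Real.log 2) (ε := ε) (c := 2 * s) (M := M) (by linarith) hε0 (by
      have : 1 / (M : ℝ) * (2 * Real.log 2) * (M - 1) ≤ ε * (M - 1) := by
        gcongr
        linarith
      refine le_trans ?_ this
      have e : 1 / (M : ℝ) * (2 * Real.log 2) * (M - 1) = 2 * Real.log 2 * (1 - 1 / M) := by
        field_simp
      rw [e]
      nlinarith) (by
      push_cast
      have h3 : (s : ℝ) * M * (4 * Real.log 2) ≤ 4500 * Real.log M * M * (4 * Real.log 2) := by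
        gcongr
      have h4 : 1 ≤ M * Real.log M := by nlinarith
      nlinarith)
  rw [← hQe] at h1 h2
  obtain ⟨n', hn', hl⟩ := hlab k a hk
  have hN0 : (0 : ℝ) < 2 ^ a * Q ^ k := by positivity
  have hlogN : Real.log (2 ^ a * Q ^ k) = a * Real.log 2 + k * Real.log Q := by
    rw [Real.log_mul (by positivity) (by positivity), Real.log_pow, Real.log_pow]
  rw [← hlogN] at h1 h2
  have h0 : (0 : ℝ) < 1 + 3000 / M := by positivity
  refine ⟨2 ^ a * Q ^ k, hl.mono ?_, ?_⟩
  · have : (1 + 3000 / M) * (2 ^ a * Q ^ k) ≤ (n : ℝ) + 1 := by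
      rw [← Real.log_le_log_iff (by positivity) (by positivity), Real.log_mul h0.ne' hN0.ne']
      linarith
    have := hn'.trans this
    exact_mod_cast (add_le_add_iff_right (1 : ℝ)).1 this
  · have hexp : Real.exp ε ≤ 1 + 1400 * (1 / M) := by
      have h3 : ε ≤ Real.log (1 + 1400 * (1 / M)) := by
        have h4 := Real.one_sub_inv_le_log_of_pos (show (0 : ℝ) < 1 + 1400 * (1 / M) by positivity)
        refine le_trans ?_ h4
        refine hε2.trans ?_
        generalize (1 / M : ℝ) = d at *
        rw [le_sub_iff_add_le, ← le_sub_iff_add_le', inv_le_iff_one_le_mul₀ (by positivity)]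
        nlinarith
      exact (Real.le_log_iff_exp_le (by positivity)).1 h3
    have h5 : (n : ℝ) + 1 ≤ (1 + 3000 / M) * (2 ^ a * Q ^ k) * Real.exp ε := by
      rw [← Real.log_le_log_iff (by positivity) (by positivity), Real.log_mul (by positivity)
        (by positivity), Real.log_exp, Real.log_mul h0.ne' hN0.ne']
      linarith
    refine h5.trans ?_
    have e3 : (3000 : ℝ) / M = 3000 * (1 / M) := by ring
    have e5 : (5000 : ℝ) / M = 5000 * (1 / M) := by ring
    push_cast
    rw [e3, e5]
    exact mul_mul_le_of_le hd0.le (hd.trans (by norm_num)) hN0.le hexp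

/-- Asymptotically perfect coverings of the binary Hamming spaces by unit balls. -/
theorem eventually_exists_covering :
    ∀ᶠ n : ℕ in Filter.atTop, ∃ K : Finset (Fin n → ZMod 2),
      (∀ x, ∃ y ∈ K, DifferAtMostOnce x y) ∧
      (K.card : ℝ) / 2 ^ n ≤
        (1 + 500000000 * Real.log (Real.log n) / Real.log n) * (1 / ((n : ℝ) + 1)) := by
  have hlogtop : Filter.Tendsto (fun n : ℕ => Real.log n) Filter.atTop Filter.atTop :=
    Real.tendsto_log_atTop.comp tendsto_natCast_atTop_atTop
  have hloglog : Filter.Tendsto (fun n : ℕ => Real.log (Real.log n)) Filter.atTop Filter.atTop :=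
    Real.tendsto_log_atTop.comp hlogtop
  have hxtop : Filter.Tendsto (fun n : ℕ => Real.log n / (100000 * Real.log (Real.log n)))
      Filter.atTop Filter.atTop := by
    have h1 : Filter.Tendsto (fun x : ℝ => x / (100000 * Real.log x)) Filter.atTop Filter.atTop := by
      have h2 : Filter.Tendsto (fun x : ℝ => 100000 * Real.log x / x) Filter.atTop
          (nhdsWithin 0 (Set.Ioi 0)) := by
        refine tendsto_nhdsWithin_iff.2 ⟨?_, ?_⟩
        · have h3 := (Real.isLittleO_log_id_atTop.tendsto_div_nhds_zero).const_mul (100000 : ℝ)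
          simpa [mul_div_assoc] using h3
        · filter_upwards [Filter.eventually_gt_atTop 1] with x hx
          have := Real.log_pos hx
          exact Set.mem_Ioi.2 (by positivity)
      simpa [Function.comp_def] using tendsto_inv_nhdsGT_zero.comp h2
    exact h1.comp hlogtop
  have hceil : Filter.Tendsto (fun n : ℕ => ⌈Real.log n / (100000 * Real.log (Real.log n))⌉₊)
      Filter.atTop Filter.atTop := tendsto_nat_ceil_atTop.comp hxtop
  obtain ⟨M₀, hM₀⟩ := Filter.eventually_atTop.1 eventually_hasLabelling
  filter_upwards [hceil.eventually_ge_atTop (M₀ + 1), hxtop.eventually_ge_atTop 1,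
    hloglog.eventually_ge_atTop 1, hlogtop.eventually_ge_atTop 1] with n hMn hx1 hll hl1
  set x := Real.log n / (100000 * Real.log (Real.log n)) with hx
  -- Bertrand's postulate supplies a prime `M` of the right size; primality is what Cauchy–Davenport
  -- needs.
  obtain ⟨M, hMp, hM1, hM2⟩ := Nat.exists_prime_lt_and_le_two_mul ⌈x⌉₊ (by omega)
  have hxM : x ≤ M := (Nat.le_ceil x).trans (by exact_mod_cast hM1.le)
  have hMx : (M : ℝ) ≤ 4 * x := by
    have h1 : (⌈x⌉₊ : ℝ) < x + 1 := Nat.ceil_lt_add_one (by linarith)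
    have h2 : (M : ℝ) ≤ 2 * ⌈x⌉₊ := by exact_mod_cast hM2
    linarith
  have hMpos : (0 : ℝ) < M := by linarith
  have hxl : x * (100000 * Real.log (Real.log n)) = Real.log n := by
    rw [hx, div_mul_cancel₀]; positivity
  have hMlog : Real.log M ≤ Real.log (Real.log n) := by
    refine Real.log_le_log hMpos (hMx.trans ?_)
    nlinarith
  have hcond : 13000 * M * Real.log M ≤ Real.log n := by
    calc 13000 * M * Real.log M ≤ 13000 * (4 * x) * Real.log (Real.log n) := by gcongr
      _ ≤ x * (100000 * Real.log (Real.log n)) := by nlinarith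
      _ = _ := hxl
  obtain ⟨N, hN, hnN⟩ := hM₀ M (by omega) hMp n hcond
  obtain ⟨K, hK, hcard⟩ := hN.exists_covering
  refine ⟨K, hK, ?_⟩
  have hcard' : (K.card : ℝ) * N ≤ 2 ^ n := by exact_mod_cast hcard
  -- From `M ≥ x`; the constant is `5000 * 100000`.
  have hinv : 5000 / (M : ℝ) ≤ 500000000 * Real.log (Real.log n) / Real.log n := by
    rw [div_le_div_iff₀ hMpos (by positivity)]
    calc 5000 * Real.log n = 500000000 * Real.log (Real.log n) * x := by linear_combination -5000 * hxl
      _ ≤ 500000000 * Real.log (Real.log n) * M := by gcongr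
  rw [div_le_iff₀ (by positivity), mul_one_div, div_mul_eq_mul_div, le_div_iff₀ (by positivity)]
  calc (K.card : ℝ) * (n + 1) ≤ K.card * ((1 + 5000 / M) * N) := by gcongr
    _ = (1 + 5000 / M) * (K.card * N) := by ring
    _ ≤ _ := by gcongr

/-! ### Unit balls of the lattice and the lower bound. -/

theorem mem_graphBall_latticeGraph {n : ℕ} {u v : Fin n → ℤ} :
    u ∈ graphBall (latticeGraph n) 1 v ↔ ∑ i, |u i - v i| ≤ 1 := by
  have h0 : 0 ≤ ∑ i, |u i - v i| := Finset.sum_nonneg fun _ _ => abs_nonneg _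
  have h1 : u = v ↔ ∑ i, |u i - v i| = 0 := by
    rw [Finset.sum_eq_zero_iff_of_nonneg fun _ _ => abs_nonneg _]
    simp [sub_eq_zero, funext_iff]
  have h2 : u ∈ graphBall (latticeGraph n) 1 v ↔ (latticeGraph n).Adj u v ∨ u = v := by
    rw [graphBall, Set.mem_ofPred_eq, Nat.cast_one]
    exact SimpleGraph.edist_le_one_iff_adj_or_eq
  have h3 : (latticeGraph n).Adj u v ↔ ∑ i, |u i - v i| = 1 := Iff.rfl
  rw [h2, h1, h3]
  omega

theorem abs_add_abs_le_sum {n : ℕ} (d : Fin n → ℤ) {i j : Fin n} (hij : i ≠ j) :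
    |d i| + |d j| ≤ ∑ l, |d l| := by
  rw [← Finset.sum_pair (f := fun l => |d l|) hij]
  exact Finset.sum_le_univ_sum_of_nonneg fun _ => abs_nonneg _

/-- The vertices of the unit ball of the lattice. -/
def ballPoint {n : ℕ} (v : Fin n → ℤ) : Option (Fin n × Bool) → Fin n → ℤ
  | none => v
  | some (i, b) => Function.update v i (v i + if b then 1 else -1)

theorem mem_graphBall_iff_exists_ballPoint {n : ℕ} {u v : Fin n → ℤ} :
    u ∈ graphBall (latticeGraph n) 1 v ↔ ∃ o, ballPoint v o = u := by
  rw [mem_graphBall_latticeGraph]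
  constructor
  · intro h
    by_cases huv : ∃ i, u i ≠ v i
    · obtain ⟨i, hi⟩ := huv
      have hj : ∀ j, j ≠ i → u j = v j := by
        intro j hj
        have h2 := (abs_add_abs_le_sum (fun l => u l - v l) hj).trans h
        have h3 := abs_pos.2 (sub_ne_zero.2 hi)
        have h4 := abs_nonneg (u j - v j)
        have h5 : |u j - v j| = 0 := by linarith
        exact sub_eq_zero.1 (abs_eq_zero.1 h5)
      have hi1 : |u i - v i| ≤ 1 :=
        (Finset.single_le_sum (f := fun l => |u l - v l|) (fun _ _ => abs_nonneg _)
          (Finset.mem_univ i)).trans h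
      rw [abs_le] at hi1
      refine ⟨some (i, decide (v i < u i)), ?_⟩
      funext j
      by_cases hji : j = i
      · subst hji
        simp only [ballPoint, Function.update_self, decide_eq_true_eq]
        split_ifs <;> omega
      · simp [ballPoint, Function.update_of_ne hji, hj j hji]
    · push Not at huv
      exact ⟨none, (funext huv).symm⟩
  · rintro ⟨o, rfl⟩
    rcases o with _ | ⟨i, b⟩
    · simp [ballPoint]
    · rw [Finset.sum_eq_single i]
      · cases b <;> simp [ballPoint]
      · intro j _ hj
        simp [ballPoint, Function.update_of_ne hj]
      · simp

theorem mem_graphBall_comm {V : Type*} {G : SimpleGraph V} {r : ℕ} {u v : V} :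
    u ∈ graphBall G r v ↔ v ∈ graphBall G r u := by
  simp only [graphBall, Set.mem_ofPred_eq, SimpleGraph.edist_comm]

/-- The box as a finite set. -/
noncomputable def boxFinset (n m : ℕ) : Finset (Fin n → ℤ) :=
  Fintype.piFinset fun _ => Finset.Icc (-(m : ℤ)) m

theorem mem_boxFinset {n m : ℕ} {x : Fin n → ℤ} : x ∈ boxFinset n m ↔ x ∈ latticeBox n m := by
  simp [boxFinset, latticeBox, abs_le]

theorem card_boxFinset (n m : ℕ) : (boxFinset n m).card = (2 * m + 1) ^ n := by
  rw [boxFinset, Fintype.card_piFinset_const, Int.card_Icc]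
  congr 1
  omega

theorem ncard_latticeBox (n m : ℕ) : (latticeBox n m).ncard = (2 * m + 1) ^ n := by
  rw [← card_boxFinset, ← Set.ncard_coe_finset]
  congr 1
  ext x
  exact mem_boxFinset.symm

open Classical in
theorem ncard_inter_latticeBox {n : ℕ} (C : Set (Fin n → ℤ)) (m : ℕ) :
    (C ∩ latticeBox n m).ncard = ((boxFinset n m).filter (· ∈ C)).card := by
  rw [← Set.ncard_coe_finset]
  congr 1
  ext x
  simp [mem_boxFinset, and_comm]

/-- Double counting over the box of radius `m`; balls around its points stay inside radius `m + 1`.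
-/
theorem two_mul_card_box_le {n : ℕ} {C : Set (Fin n → ℤ)}
    (hC : IsIdentifyingCode (latticeGraph n) 1 C) (m : ℕ) :
    2 * (2 * m + 1) ^ n ≤ (C ∩ latticeBox n (m + 1)).ncard * (2 * n + 2) := by
  classical
  obtain ⟨-, hne, hinj⟩ := hC
  rw [ncard_inter_latticeBox, ← card_boxFinset]
  set D := (boxFinset n (m + 1)).filter (· ∈ C) with hD
  let N : (Fin n → ℤ) → Finset (Fin n → ℤ) := fun v =>
    D.filter (· ∈ graphBall (latticeGraph n) 1 v)
  have hN : ∀ v ∈ boxFinset n m, (N v : Set (Fin n → ℤ)) = graphBall (latticeGraph n) 1 v ∩ C := by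
    intro v hv
    ext c
    simp only [N, hD, Finset.coe_filter, Finset.mem_filter, Set.mem_ofPred_eq, Set.mem_inter_iff]
    refine ⟨fun h => ⟨h.2, h.1.2⟩, fun h => ⟨⟨?_, h.2⟩, h.1⟩⟩
    rw [mem_boxFinset] at hv ⊢
    intro i
    have h1 := mem_graphBall_latticeGraph.1 h.1
    have h2 : |c i - v i| ≤ 1 :=
      (Finset.single_le_sum (f := fun l => |c l - v l|) (fun _ _ => abs_nonneg _)
        (Finset.mem_univ i)).trans h1
    have h3 := hv i
    rw [abs_le] at h2 h3 ⊢
    push_cast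
    omega
  have hpos : ∀ v ∈ boxFinset n m, 1 ≤ (N v).card := by
    intro v hv
    rw [Nat.one_le_iff_ne_zero, Finset.card_ne_zero, ← Finset.coe_nonempty, hN v hv]
    exact hne v
  -- A singleton identifying set determines its vertex, so there is at most one per codeword.
  have hone : ((boxFinset n m).filter fun v => (N v).card = 1).card ≤ D.card := by
    have hch : ∀ v, ∃ c, (N v).card = 1 → N v = {c} := by
      intro v
      by_cases h : (N v).card = 1
      · obtain ⟨c, hc⟩ := Finset.card_eq_one.1 h
        exact ⟨c, fun _ => hc⟩
      · exact ⟨v, fun h' => absurd h' h⟩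
    choose f hf using hch
    refine Finset.card_le_card_of_injOn f ?_ ?_
    · intro v hv
      have h1 := hf v (Finset.mem_filter.1 hv).2
      have h2 : f v ∈ N v := by rw [h1]; exact Finset.mem_singleton_self _
      exact (Finset.mem_filter.1 h2).1
    · intro v hv w hw hvw
      by_contra hne'
      have hv' := Finset.mem_filter.1 hv
      have hw' := Finset.mem_filter.1 hw
      apply hinj v w hne'
      rw [← hN v hv'.1, ← hN w hw'.1, hf v hv'.2, hf w hw'.2, hvw]
  have hsum : 2 * (boxFinset n m).card ≤ ∑ v ∈ boxFinset n m, (N v).card + D.card := by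
    calc 2 * (boxFinset n m).card = ∑ v ∈ boxFinset n m, 2 := by simp [mul_comm]
      _ ≤ ∑ v ∈ boxFinset n m, ((N v).card + if (N v).card = 1 then 1 else 0) := by
          refine Finset.sum_le_sum fun v hv => ?_
          have := hpos v hv
          split_ifs <;> omega
      _ = ∑ v ∈ boxFinset n m, (N v).card
            + ((boxFinset n m).filter fun v => (N v).card = 1).card := by
          rw [Finset.sum_add_distrib, Finset.card_filter]
      _ ≤ _ := by gcongr
  have hdouble : ∑ v ∈ boxFinset n m, (N v).card ≤ D.card * (2 * n + 1) := by
    calc ∑ v ∈ boxFinset n m, (N v).card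
        = ∑ c ∈ D, ((boxFinset n m).filter (fun v => c ∈ graphBall (latticeGraph n) 1 v)).card :=
          Finset.sum_card_bipartiteAbove_eq_sum_card_bipartiteBelow
            (fun v c => c ∈ graphBall (latticeGraph n) 1 v)
      _ ≤ ∑ c ∈ D, (2 * n + 1) := by
          refine Finset.sum_le_sum fun c _ => ?_
          calc _ ≤ ((Finset.univ : Finset (Option (Fin n × Bool))).image (ballPoint c)).card := by
                refine Finset.card_le_card fun v hv => ?_
                have h1 := mem_graphBall_comm.1 (Finset.mem_filter.1 hv).2
                obtain ⟨o, ho⟩ := mem_graphBall_iff_exists_ballPoint.1 h1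
                exact Finset.mem_image.2 ⟨o, Finset.mem_univ _, ho⟩
            _ ≤ _ := Finset.card_image_le
            _ = 2 * n + 1 := by
                simp [Fintype.card_option, Fintype.card_prod, mul_comm]
      _ = D.card * (2 * n + 1) := by simp
  calc 2 * (boxFinset n m).card ≤ D.card * (2 * n + 1) + D.card := hsum.trans (by gcongr)
    _ = _ := by ring

theorem density_le_one {n : ℕ} (C : Set (Fin n → ℤ)) (m : ℕ) :
    ((C ∩ latticeBox n m).ncard : ℝ) / ((latticeBox n m).ncard : ℝ) ≤ 1 := by
  refine div_le_one_of_le₀ ?_ (Nat.cast_nonneg _)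
  exact_mod_cast Set.ncard_le_ncard Set.inter_subset_right (latticeBox_finite n m)

theorem isBoundedUnder_density {n : ℕ} (C : Set (Fin n → ℤ)) :
    Filter.IsBoundedUnder (· ≤ ·) Filter.atTop
      (fun m : ℕ => ((C ∩ latticeBox n m).ncard : ℝ) / ((latticeBox n m).ncard : ℝ)) :=
  Filter.isBoundedUnder_of ⟨1, density_le_one C⟩

theorem isCoboundedUnder_density {n : ℕ} (C : Set (Fin n → ℤ)) :
    Filter.IsCoboundedUnder (· ≤ ·) Filter.atTop
      (fun m : ℕ => ((C ∩ latticeBox n m).ncard : ℝ) / ((latticeBox n m).ncard : ℝ)) :=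
  Filter.IsBoundedUnder.isCoboundedUnder_le
    (Filter.isBoundedUnder_of ⟨0, fun _ => by positivity⟩)

theorem le_codeDensity {n : ℕ} {C : Set (Fin n → ℤ)}
    (hC : IsIdentifyingCode (latticeGraph n) 1 C) : 1 / ((n : ℝ) + 1) ≤ codeDensity C := by
  have hinv : Filter.Tendsto (fun m : ℕ => (1 : ℝ) / (m + 1)) Filter.atTop (nhds 0) :=
    tendsto_one_div_add_atTop_nhds_zero_nat
  have hlim : Filter.Tendsto
      (fun m : ℕ => (1 - 2 * (1 / ((m : ℝ) + 1))) ^ n * (1 / ((n : ℝ) + 1))) Filter.atTop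
      (nhds (1 / ((n : ℝ) + 1))) := by
    simpa using (((hinv.const_mul 2).const_sub 1).pow n).mul_const (1 / ((n : ℝ) + 1))
  rw [← hlim.limsup_eq]
  refine Filter.limsup_le_limsup ?_ hlim.isCoboundedUnder_le (isBoundedUnder_density C)
  filter_upwards [Filter.eventually_ge_atTop 1] with m hm
  obtain ⟨l, rfl⟩ := Nat.exists_eq_add_of_le' hm
  have h := two_mul_card_box_le hC l
  have h' : 2 * (2 * (l : ℝ) + 1) ^ n ≤ (C ∩ latticeBox n (l + 1)).ncard * (2 * n + 2) := by
    exact_mod_cast h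
  rw [ncard_latticeBox, le_div_iff₀ (by positivity), mul_one_div, div_mul_eq_mul_div,
    div_le_iff₀ (by positivity)]
  push_cast
  -- The ratio of consecutive side lengths is `(2l + 1) / (2l + 3) ≥ 1 - 2 / (l + 2)`.
  have h1 : (1 - 2 * (1 / ((l : ℝ) + 1 + 1))) ^ n * (2 * ((l : ℝ) + 1) + 1) ^ n
      ≤ (2 * (l : ℝ) + 1) ^ n := by
    rw [← mul_pow]
    have h0 : (0 : ℝ) < (l : ℝ) + 1 + 1 := by positivity
    have hl : (0 : ℝ) ≤ l := Nat.cast_nonneg l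
    have e : (1 - 2 * (1 / ((l : ℝ) + 1 + 1))) * (2 * ((l : ℝ) + 1) + 1)
        = l * (2 * l + 3) / (l + 1 + 1) := by
      field_simp
      ring
    rw [e]
    refine pow_le_pow_left₀ (by positivity) ?_ n
    rw [div_le_iff₀ h0]
    nlinarith
  linarith

/-! ### Lifting binary coverings to identifying codes. -/

/-- Reduction of the coordinates modulo `2`. -/
def parity {n : ℕ} (x : Fin n → ℤ) : Fin n → ZMod 2 := fun i => (x i : ZMod 2)

/-- Both points are within one of `u` in coordinate `i`, which forces `u i = v i`; that coordinate
then uses up the whole distance. -/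
theorem eq_of_opposite_mem_graphBall {n : ℕ} {u v : Fin n → ℤ} {i : Fin n}
    (h1 : Function.update v i (v i + 1) ∈ graphBall (latticeGraph n) 1 u)
    (h2 : Function.update v i (v i - 1) ∈ graphBall (latticeGraph n) 1 u) : u = v := by
  rw [mem_graphBall_latticeGraph] at h1 h2
  have a1 := (Finset.single_le_sum (f := fun l => |Function.update v i (v i + 1) l - u l|)
    (fun _ _ => abs_nonneg _) (Finset.mem_univ i)).trans h1
  have a2 := (Finset.single_le_sum (f := fun l => |Function.update v i (v i - 1) l - u l|)
    (fun _ _ => abs_nonneg _) (Finset.mem_univ i)).trans h2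
  simp only [Function.update_self] at a1 a2
  rw [abs_le] at a1 a2
  have hi : u i = v i := by omega
  funext j
  by_cases hj : j = i
  · rw [hj, hi]
  · have h3 := (abs_add_abs_le_sum (fun l => Function.update v i (v i + 1) l - u l) hj).trans h1
    simp only [Function.update_self, Function.update_of_ne hj, hi] at h3
    have h4 : |v j - u j| = 0 := by
      have := abs_nonneg (v j - u j)
      have e : |v i + 1 - v i| = 1 := by simp
      omega
    exact (sub_eq_zero.1 (abs_eq_zero.1 h4)).symm

theorem parity_update_eq {n : ℕ} {x : Fin n → ℤ} {y : Fin n → ZMod 2} {i : Fin n}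
    (hy : DifferAtMostOnce (parity x) y) (hi : parity x i ≠ y i) {e : ℤ} (he : (e : ZMod 2) = 1) :
    parity (Function.update x i (x i + e)) = y := by
  funext j
  by_cases hj : j = i
  · subst hj
    simp only [parity, Function.update_self] at hi ⊢
    push_cast
    rw [he]
    revert hi
    generalize ((x j : ℤ) : ZMod 2) = a
    generalize y j = b
    revert a b
    decide
  · have h1 : parity x j = y j := by
      by_contra h
      exact hj (hy j i h hi)
    rw [← h1]
    simp [parity, Function.update_of_ne hj]

/-- Binary coverings lift to identifying codes of the lattice. -/
theorem isIdentifyingCode_parity_preimage {n : ℕ} {K : Finset (Fin n → ZMod 2)}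
    (hK : ∀ x, ∃ y ∈ K, DifferAtMostOnce x y) :
    IsIdentifyingCode (latticeGraph n) 1 {x | parity x ∈ K} := by
  -- As `1 = -1` modulo `2`, a single wrong parity can be corrected by moving in either direction.
  have hcov : ∀ v : Fin n → ℤ, parity v ∈ K ∨ ∃ i,
      parity (Function.update v i (v i + 1)) ∈ K ∧ parity (Function.update v i (v i - 1)) ∈ K := by
    intro v
    obtain ⟨y, hy, hvy⟩ := hK (parity v)
    by_cases h : ∃ i, parity v i ≠ y i
    · obtain ⟨i, hi⟩ := h
      refine .inr ⟨i, ?_, ?_⟩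
      · rwa [parity_update_eq hvy hi (by simp)]
      · rw [sub_eq_add_neg]
        rwa [parity_update_eq hvy hi (by decide)]
    · push Not at h
      left
      rwa [funext h]
  have hball : ∀ (v : Fin n → ℤ) o, ballPoint v o ∈ graphBall (latticeGraph n) 1 v :=
    fun v o => mem_graphBall_iff_exists_ballPoint.2 ⟨o, rfl⟩
  have hplus : ∀ (v : Fin n → ℤ) i,
      Function.update v i (v i + 1) ∈ graphBall (latticeGraph n) 1 v :=
    fun v i => by simpa [ballPoint] using hball v (some (i, true))
  have hminus : ∀ (v : Fin n → ℤ) i,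
      Function.update v i (v i - 1) ∈ graphBall (latticeGraph n) 1 v :=
    fun v i => by simpa [ballPoint, sub_eq_add_neg] using hball v (some (i, false))
  have hself : ∀ v : Fin n → ℤ, v ∈ graphBall (latticeGraph n) 1 v := fun v => hball v none
  have hnonempty : ∀ v : Fin n → ℤ,
      (graphBall (latticeGraph n) 1 v ∩ {x | parity x ∈ K}).Nonempty := by
    intro v
    rcases hcov v with h | ⟨i, h, -⟩
    · exact ⟨v, hself v, h⟩
    · exact ⟨_, hplus v i, h⟩
  have hpair : ∀ (u v : Fin n → ℤ) i, parity (Function.update v i (v i + 1)) ∈ K →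
      parity (Function.update v i (v i - 1)) ∈ K →
      graphBall (latticeGraph n) 1 u ∩ {x | parity x ∈ K}
        = graphBall (latticeGraph n) 1 v ∩ {x | parity x ∈ K} → u = v := by
    intro u v i h1 h2 h
    refine eq_of_opposite_mem_graphBall (i := i) ?_ ?_
    · exact (h.symm.subset ⟨hplus v i, h1⟩).1
    · exact (h.symm.subset ⟨hminus v i, h2⟩).1
  refine ⟨(hnonempty 0).mono Set.inter_subset_right, hnonempty, fun u v huv h => ?_⟩
  rcases hcov v with hv | ⟨i, h1, h2⟩
  · rcases hcov u with hu | ⟨i, h1, h2⟩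
    · have hub : u ∈ graphBall (latticeGraph n) 1 v := (h.subset ⟨hself u, hu⟩).1
      obtain ⟨o, rfl⟩ := mem_graphBall_iff_exists_ballPoint.1 hub
      rcases o with _ | ⟨i, b⟩
      · exact huv rfl
      · have hpar : parity (Function.update v i (v i + 1))
            = parity (Function.update v i (v i - 1)) := by
          funext j
          by_cases hj : j = i
          · subst hj
            simp only [parity, Function.update_self]
            push_cast
            generalize ((v j : ℤ) : ZMod 2) = a
            revert a
            decide
          · simp [parity, Function.update_of_ne hj]
        cases b
        · have hu' : parity (Function.update v i (v i - 1)) ∈ K := by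
            simpa [ballPoint, sub_eq_add_neg] using hu
          exact huv (hpair _ v i (hpar ▸ hu') hu' h)
        · have hu' : parity (Function.update v i (v i + 1)) ∈ K := by
            simpa [ballPoint] using hu
          exact huv (hpair _ v i hu' (hpar ▸ hu') h)
    · exact huv (hpair v u i h1 h2 h.symm).symm
  · exact huv (hpair u v i h1 h2 h)

theorem card_parity_class_le (m : ℕ) (c : ZMod 2) :
    ((Finset.Icc (-(m : ℤ)) m).filter (fun z : ℤ => (z : ZMod 2) = c)).card ≤ m + 1 := by
  rw [← Finset.card_range (m + 1)]
  -- The map `z ↦ ⌊(z + m) / 2⌋` sends the interval into `{0, …, m}` and separates integers of equal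
  -- parity.
  refine Finset.card_le_card_of_injOn (fun z => ((z + m) / 2).toNat) ?_ ?_
  · intro z hz
    have hz' := Finset.mem_Icc.1 (Finset.mem_filter.1 hz).1
    simp only [Finset.coe_range, Set.mem_Iio]
    omega
  · intro z hz w hw hzw
    have hz' := Finset.mem_Icc.1 (Finset.mem_filter.1 hz).1
    have hw' := Finset.mem_Icc.1 (Finset.mem_filter.1 hw).1
    have h1 : (z : ZMod 2) = w :=
      (Finset.mem_filter.1 hz).2.trans (Finset.mem_filter.1 hw).2.symm
    have h2 := (ZMod.intCast_eq_intCast_iff_dvd_sub z w 2).1 h1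
    simp only at hzw
    push_cast at h2
    omega

theorem ncard_parity_preimage_le {n : ℕ} (K : Finset (Fin n → ZMod 2)) (m : ℕ) :
    ({x | parity x ∈ K} ∩ latticeBox n m).ncard ≤ K.card * (m + 1) ^ n := by
  classical
  generalize hC : {x : Fin n → ℤ | parity x ∈ K} = C
  rw [ncard_inter_latticeBox]
  refine (Finset.card_le_card (t := K.biUnion fun y => Fintype.piFinset fun i =>
    (Finset.Icc (-(m : ℤ)) m).filter (fun z : ℤ => (z : ZMod 2) = y i)) fun x hx => ?_).trans
    (Finset.card_biUnion_le_card_mul _ _ _ fun y _ => ?_)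
  · rw [Finset.mem_filter, ← hC, boxFinset, Fintype.mem_piFinset] at hx
    refine Finset.mem_biUnion.2 ⟨parity x, hx.2, Fintype.mem_piFinset.2 fun i => ?_⟩
    exact Finset.mem_filter.2 ⟨hx.1 i, rfl⟩
  rw [Fintype.card_piFinset]
  calc _ ≤ ∏ _i : Fin n, (m + 1) := Finset.prod_le_prod' fun i _ => card_parity_class_le m (y i)
    _ = (m + 1) ^ n := by simp

/-- Each parity class has at most `(m + 1) ^ n` of the `(2 m + 1) ^ n` points of the box, a
proportion tending to `2 ^ (-n)`. -/
theorem codeDensity_parity_preimage_le {n : ℕ} (K : Finset (Fin n → ZMod 2)) :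
    codeDensity {x : Fin n → ℤ | parity x ∈ K} ≤ (K.card : ℝ) / 2 ^ n := by
  have hinv : Filter.Tendsto (fun m : ℕ => (1 : ℝ) / (m + 1)) Filter.atTop (nhds 0) :=
    tendsto_one_div_add_atTop_nhds_zero_nat
  have hlim : Filter.Tendsto
      (fun m : ℕ => (K.card : ℝ) / 2 ^ n * (1 + 1 / ((m : ℝ) + 1)) ^ n) Filter.atTop
      (nhds ((K.card : ℝ) / 2 ^ n)) := by
    simpa using ((hinv.const_add 1).pow n).const_mul ((K.card : ℝ) / 2 ^ n)
  rw [← hlim.limsup_eq]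
  refine Filter.limsup_le_limsup (Filter.Eventually.of_forall fun m => ?_)
    (isCoboundedUnder_density _) hlim.isBoundedUnder_le
  have h : (({x | parity x ∈ K} ∩ latticeBox n m).ncard : ℝ) ≤ K.card * ((m : ℝ) + 1) ^ n := by
    exact_mod_cast ncard_parity_preimage_le K m
  simp only
  rw [ncard_latticeBox, div_le_iff₀ (by positivity)]
  refine h.trans ?_
  rw [div_mul_eq_mul_div, div_mul_eq_mul_div, le_div_iff₀ (by positivity), mul_assoc, mul_assoc]
  push_cast
  rw [← mul_pow, ← mul_pow]
  refine mul_le_mul_of_nonneg_left (pow_le_pow_left₀ (by positivity) ?_ n) (Nat.cast_nonneg _)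
  have h0 : (0 : ℝ) < (m : ℝ) + 1 := by positivity
  have e : (1 + 1 / ((m : ℝ) + 1)) * (2 * m + 1) = 2 * m + 1 + (2 * m + 1) / (m + 1) := by
    field_simp
  have h1 : 1 ≤ (2 * (m : ℝ) + 1) / (m + 1) := by
    rw [one_le_div h0]
    have : (0 : ℝ) ≤ m := Nat.cast_nonneg m
    linarith
  linarith

theorem mainTheorem6 :
    ∃ b : ℝ, ∃ N : ℕ, ∀ n : ℕ, N ≤ n →
      1 / ((n : ℝ) + 1) ≤ minCodeDensity n 1 ∧
        minCodeDensity n 1 ≤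
          (1 + b * Real.log (Real.log (n : ℝ)) / Real.log (n : ℝ)) * (1 / ((n : ℝ) + 1)) := by
  obtain ⟨N, hN⟩ := Filter.eventually_atTop.1 eventually_exists_covering
  refine ⟨500000000, N, fun n hn => ?_⟩
  obtain ⟨K, hK, hcard⟩ := hN n hn
  have hcode := isIdentifyingCode_parity_preimage hK
  have hlower : ∀ d ∈ {d : ℝ | ∃ C : Set (Fin n → ℤ), IsIdentifyingCode (latticeGraph n) 1 C ∧
      d = codeDensity C}, 1 / ((n : ℝ) + 1) ≤ d := by
    rintro d ⟨C, hC, rfl⟩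
    exact le_codeDensity hC
  refine ⟨le_csInf ⟨_, _, hcode, rfl⟩ hlower, ?_⟩
  exact (csInf_le ⟨_, hlower⟩ ⟨_, hcode, rfl⟩).trans
    ((codeDensity_parity_preimage_le K).trans hcard)
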